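/- Let $\gamma\subset\mathbb R^2$ be a (closed, nondegenerate) regular octagon. The outer billiard map $T$ with table $\gamma$ is the following partial map of the plane: for a point $p\notin\gamma$, draw the right tangent ray from $p$ to $\gamma$ (the one having $\gamma$ on its left, as seen from $p$); if it touches $\gamma$ at exactly one point $q$, then $T(p)=2q-p$ is the reflection of $p$ in $q$; if it contains a side of $\gamma$, then $T(p)$ is undefined. A point $p\notin\gamma$ is called periodic if for some integer $n\ge 1$ the iterate $T^n(p)$ is defined and equals $p$. Theorem. The periodic points form a set of full Lebesgue measure outside the table: the set of all points $p\in\mathbb R^2\setminus\gamma$ that are not periodic has Lebesgue measure zero. -/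

import Mathlib

namespace OuterBilliard

/-- The oriented area `u × v` of two plane vectors, positive when `v` points to the left of `u`. -/
def cross (u v : ℂ) : ℝ := u.re * v.im - u.im * v.re

/-- `q` is a point of contact of `γ` with the right tangent to `γ` from `p`: `q` lies in `γ`, and
for an observer at `p` looking towards `q` no point of `γ` is strictly to the right of the line
of sight. -/
def IsRightTangentPoint (γ : Set ℂ) (p q : ℂ) : Prop :=
  q ∈ γ ∧ ∀ x ∈ γ, 0 ≤ cross (q - p) (x - p)

/-- The outer billiard map `T` of the table `γ`, a partial map of the plane. It is defined at the
points `p` outside `γ` whose right tangent touches `γ` at exactly one point `q`, and then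
`T p = 2 q - p` is the reflection of `p` in `q`. -/
noncomputable def outerBilliard (γ : Set ℂ) : ℂ →. ℂ := fun p =>
  { Dom := p ∉ γ ∧ ∃! q, IsRightTangentPoint γ p q
    get := fun h => 2 * h.2.choose - p }

/-- The iterates `T ^ n` of a partial map `T`; `T ^ n` is defined at `p` when all `n` successive
applications are. -/
def iterate (T : ℂ →. ℂ) : ℕ → (ℂ →. ℂ)
  | 0 => PFun.id ℂ
  | n + 1 => T.comp (iterate T n)

/-- `p` is a periodic point of the outer billiard with table `γ`: it is outside `γ`, and `T ^ n p`
is defined and equal to `p` for some `n ≥ 1`. -/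
def IsPeriodicPoint (γ : Set ℂ) (p : ℂ) : Prop :=
  p ∉ γ ∧ ∃ n : ℕ, 1 ≤ n ∧ p ∈ iterate (outerBilliard γ) n p

/-- `γ` is a (closed, nondegenerate) regular octagon in the plane: for some centre `c` and some
`w ≠ 0` it is the convex hull of the vertices obtained by rotating `c + w` about `c` by the
multiples of `π / 4`. -/
def IsRegularOctagon (γ : Set ℂ) : Prop :=
  ∃ c w : ℂ, w ≠ 0 ∧ γ = convexHull ℝ
    (Set.range fun k : Fin 8 => c + w * Complex.exp (((k : ℕ) : ℂ) * (Real.pi / 4 : ℝ) * Complex.I))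

end OuterBilliard

/-!
The proof reduces the outer billiard to a piecewise isometry of a wedge and shows that the latter
is self-similar.

Take the octagon with centre `0` and side `2`. The eight rotations of the octagon identify all
points with the same position relative to their tangent vertex, and the billiard becomes a
piecewise isometry of the wedge `0 < im z < re z` (`Wedge`, `StepW`) with four branches `move j`,
a rotation by `j π / 4` followed by a translation. All pieces are bounded by lines in the eight
directions of the octagon with coefficients in `ℤ[√2]`. A point on none of these countably many
lines is `Generic`; generic points form a set of full measure, and on them regions can be covered
by open polygons without exceptions.

*Self-similarity.* Next to the apex of the wedge there is an invariant region (`base`), the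
quadrilateral with a reflex corner that an octagon tangent to both sides cuts off from the wedge.
It consists of one octagon and of three copies of itself, scaled by `√2 - 1` (`base_cover`). Let
`piecesF` be the billiard on this region. The return map to each of the three small copies is
conjugate to a second piecewise isometry `piecesG` of the region, and the return maps of `piecesG`
to the small copies are conjugate to `piecesF` again (`contractions_conj_F`,
`contractions_conj_G`). Both maps rotate the octagon, so that its points are periodic. Hence the
non-periodic points of one map lie in three copies, scaled by `√2 - 1`, of those of the other
(`wandering_subset`). As `3 (√2 - 1)² < 1`, both sets are null (`volume_wandering_F`).

*The strip.* In the strip `im z < 2 + 2 √2` of the wedge, the first return map commutes, far from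
the apex, with the translation by `4 + 2 √2` (`stepS_add_period`), because the rotation in `move
1` changes this translation by one step of `move 0` (`zeta_mul_period`). A period of the strip
consists of one octagon, which is rotated, and of two copies of the base region, and the first
returns to these copies are conjugate to `piecesF` (`gapCopies_conj_F`). So almost all points of
the strip are periodic (`volume_wanderingStrip`). Every point of the wedge is translated into the
strip by `move 0`, and as the billiard is injective, almost all points of the wedge are periodic
(`volume_wandering_wedge`).

The finitely many facts about explicit polygons are decided by computation in `ℤ[√2]`: a polygon
is a system of eight constraints (`Octagonal`), and such a system is contradictory as soon as two
or three of its constraints are (`isEmpty`). Only the soundness of these tests is needed.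
-/

namespace OuterBilliard

open MeasureTheory

/-! ### The ring of integers of the field generated by the square root of two -/

/-- Test for `0 ≤ a + b √2` in integer arithmetic. -/
def isNonneg (x : ℤ√2) : Bool :=
  (decide (0 ≤ x.re) && decide (0 ≤ x.im)) ||
  (decide (0 ≤ x.re) && decide (2 * x.im * x.im ≤ x.re * x.re)) ||
  (decide (0 ≤ x.im) && decide (x.re * x.re ≤ 2 * x.im * x.im))

/-- The embedding of `ℤ[√2]` into the real numbers. -/
noncomputable def val : ℤ√2 →+* ℝ := Zsqrtd.toReal (by norm_num)

theorem val_apply (x : ℤ√2) : val x = x.re + x.im * √2 := by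
  simp [val, Zsqrtd.toReal, Zsqrtd.lift]

theorem sqrt_two_sq : √2 * √2 = (2 : ℝ) := Real.mul_self_sqrt (by norm_num)

theorem isNonneg_sound {x : ℤ√2} (h : isNonneg x = true) : 0 ≤ val x := by
  have hs := sqrt_two_sq
  have h0 : (0 : ℝ) ≤ √2 := Real.sqrt_nonneg 2
  rw [val_apply]
  simp only [isNonneg, Bool.or_eq_true, Bool.and_eq_true, decide_eq_true_eq] at h
  have key : ∀ u v : ℝ, 0 ≤ u → v * v ≤ u * u → 0 ≤ u + v := by
    intro u v hu huv
    have := (abs_le.1 (abs_le_of_sq_le_sq (by nlinarith : v ^ 2 ≤ u ^ 2) hu)).1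
    linarith
  rcases h with (⟨ha, hb⟩ | ⟨ha, hb⟩) | ⟨ha, hb⟩
  · have ha' : (0 : ℝ) ≤ x.re := by exact_mod_cast ha
    have hb' : (0 : ℝ) ≤ x.im := by exact_mod_cast hb
    positivity
  · have ha' : (0 : ℝ) ≤ x.re := by exact_mod_cast ha
    have hb' : 2 * (x.im : ℝ) * x.im ≤ x.re * x.re := by exact_mod_cast hb
    exact key _ _ ha' (by nlinarith)
  · have ha' : (0 : ℝ) ≤ x.im := by exact_mod_cast ha
    have hb' : (x.re : ℝ) * x.re ≤ 2 * x.im * x.im := by exact_mod_cast hb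
    rw [add_comm]
    exact key _ _ (by positivity) (by nlinarith)

/-- The number `√2`, as an element of `ℤ[√2]`. -/
def rt : ℤ√2 := ⟨0, 1⟩

/-- `twoCos k = 2 cos (k π / 4)`. -/
def twoCos : Fin 8 → ℤ√2 :=
  ![⟨2, 0⟩, ⟨0, 1⟩, ⟨0, 0⟩, ⟨0, -1⟩, ⟨-2, 0⟩, ⟨0, -1⟩, ⟨0, 0⟩, ⟨0, 1⟩]

/-- `sinRatio r = sin (r π / 4) / sin (π / 4)`. -/
def sinRatio : Fin 8 → ℤ√2 :=
  ![⟨0, 0⟩, ⟨1, 0⟩, ⟨0, 1⟩, ⟨1, 0⟩, ⟨0, 0⟩, ⟨-1, 0⟩, ⟨0, -1⟩, ⟨-1, 0⟩]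

/-- The number `(√2 - 1) ^ e`. -/
def lam : ℕ → ℤ√2
  | 0 => 1
  | e + 1 => ⟨-1, 1⟩ * lam e

theorem lam_add (m n : ℕ) : lam (m + n) = lam m * lam n := by
  induction m with
  | zero => simp [lam]
  | succ m ih => rw [Nat.succ_add, lam, ih, lam, mul_assoc]

theorem lam_pos (n : ℕ) : 0 < val (lam n) := by
  induction n with
  | zero => simp [lam]
  | succ n ih =>
    rw [lam, map_mul]
    refine mul_pos ?_ ih
    rw [val_apply]
    have : (1 : ℝ) < √2 := by rw [Real.lt_sqrt] <;> norm_num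
    push_cast
    linarith

theorem lam_unit (n : ℕ) : ∃ u, lam n * u = 1 := by
  induction n with
  | zero => exact ⟨1, by simp [lam]⟩
  | succ n ih =>
    obtain ⟨u, hu⟩ := ih
    refine ⟨⟨1, 1⟩ * u, ?_⟩
    have : (⟨-1, 1⟩ : ℤ√2) * ⟨1, 1⟩ = 1 := by decide
    rw [lam]
    linear_combination hu + lam n * u * this

/-! ### Coordinates in the eight directions -/

/-- `coord k p` is twice the scalar product of `p` with the unit vector of argument `k π / 4`. -/
noncomputable def coord (k : Fin 8) (p : ℂ) : ℝ :=
  val (twoCos k) * p.re + val (twoCos (k - 2)) * p.im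

theorem coord_add (k : Fin 8) (p q : ℂ) : coord k (p + q) = coord k p + coord k q := by
  simp [coord]; ring

theorem coord_real_mul (k : Fin 8) (a : ℝ) (p : ℂ) : coord k (a * p) = a * coord k p := by
  simp [coord]; ring

theorem coord_add_four (k : Fin 8) (p : ℂ) : coord (k + 4) p = -coord k p := by
  fin_cases k <;> simp [coord, twoCos, val_apply] <;> ring

/-- The unit vectors of arguments `k π / 4`, `(k + 3) π / 4` and `(k + 5) π / 4` have a positive
linear dependence. -/
theorem coord_dependence (k : Fin 8) (p : ℂ) :
    √2 * coord k p + coord (k + 3) p + coord (k + 5) p = 0 := by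
  fin_cases k <;> simp [coord, twoCos, val_apply] <;> ring_nf <;> simp <;> ring

/-- The primitive eighth root of unity `ζ = exp (i π / 4)`. -/
noncomputable def zeta : ℂ := ⟨√2 / 2, √2 / 2⟩

theorem zeta_sq : zeta ^ 2 = √2 * zeta - 1 := by
  apply Complex.ext <;> simp [zeta, pow_two] <;> ring_nf
  simp

theorem zeta_pow_four : zeta ^ 4 = -1 := by
  have h : ((√2 : ℝ) : ℂ) * (√2 : ℝ) = 2 := by exact_mod_cast sqrt_two_sq
  have := zeta_sq
  linear_combination (zeta ^ 2 + √2 * zeta + 1) * this + zeta ^ 2 * h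

theorem zeta_pow_eight : zeta ^ 8 = 1 := by
  have := zeta_pow_four
  linear_combination (zeta ^ 4 - 1) * this

theorem norm_zeta : ‖zeta‖ = 1 := by
  have : ‖zeta‖ ^ 8 = 1 := by rw [← norm_pow, zeta_pow_eight, norm_one]
  exact (pow_eq_one_iff_of_nonneg (norm_nonneg _) (by norm_num)).1 this

theorem zeta_ne_zero : zeta ≠ 0 := by
  intro h
  have := norm_zeta
  simp [h] at this

theorem zeta_pow_mod (n : ℕ) : zeta ^ (n % 8) = zeta ^ n := by
  conv_rhs => rw [← Nat.div_add_mod n 8, pow_add, pow_mul, zeta_pow_eight, one_pow, one_mul]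

theorem zeta_pow_add (r s : Fin 8) :
    zeta ^ ((r + s : Fin 8) : ℕ) = zeta ^ (r : ℕ) * zeta ^ (s : ℕ) := by
  rw [Fin.val_add, zeta_pow_mod, pow_add]

theorem zeta_pow_mul_neg (m : Fin 8) : zeta ^ (m : ℕ) * zeta ^ ((-m : Fin 8) : ℕ) = 1 := by
  rw [← zeta_pow_add, add_neg_cancel]; rfl

/-- The powers of `ζ` in the basis `ζ, 1` of `ℤ[ζ]` over `ℤ[√2]`. -/
theorem zeta_pow_eq (r : Fin 8) :
    zeta ^ (r : ℕ) = (val (sinRatio r) : ℝ) * zeta - (val (sinRatio (r - 1)) : ℝ) := by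
  have h : ((√2 : ℝ) : ℂ) * (√2 : ℝ) = 2 := by exact_mod_cast sqrt_two_sq
  have h2 := zeta_sq
  have h4 := zeta_pow_four
  have h3 : zeta ^ 3 = zeta - √2 := by linear_combination (zeta + √2) * h2 + zeta * h
  fin_cases r <;> simp [sinRatio, val_apply]
  · exact h2
  · exact h3
  · exact h4
  · linear_combination zeta * h4
  · linear_combination zeta ^ 2 * h4 - h2
  · linear_combination zeta ^ 3 * h4 - h3

theorem coord_zeta_mul (k : Fin 8) (p : ℂ) : coord k (zeta * p) = coord (k - 1) p := by
  fin_cases k <;> simp [coord, twoCos, val_apply, zeta, show (-1 - 2 : Fin 8) = 5 from rfl] <;>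
    (try ring_nf) <;> (try simp) <;> (try ring)

theorem coord_rotate (r k : Fin 8) (p : ℂ) :
    coord k (zeta ^ (r : ℕ) * p) = coord (k - r) p := by
  fin_cases r <;> simp only [pow_succ, pow_zero, one_mul, mul_assoc, coord_zeta_mul] <;>
    congr 1 <;> revert k <;> decide

/-- The element `x + y ζ` of `ℤ[ζ]`, with `x` and `y` in `ℤ[√2]`, as a point of the plane. -/
noncomputable def vec (x y : ℤ√2) : ℂ := (val x : ℝ) + (val y : ℝ) * zeta

theorem vec_neg (x y : ℤ√2) : vec (-x) (-y) = -vec x y := by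
  simp [vec]; ring

theorem vec_add (x y x' y' : ℤ√2) : vec x y + vec x' y' = vec (x + x') (y + y') := by
  simp [vec]; ring

theorem vec_mul (a x y : ℤ√2) : vec (a * x) (a * y) = (val a : ℝ) * vec x y := by
  simp only [vec, map_mul]
  push_cast
  ring

theorem vec_natCast_mul (n : ℕ) (x y : ℤ√2) : vec (n * x) (n * y) = n * vec x y := by
  rw [vec_mul]; simp

theorem vec_rotate (r : Fin 8) (x y : ℤ√2) : zeta ^ (r : ℕ) * vec x y =
    vec (-(x * sinRatio (r - 1) + y * sinRatio r)) (x * sinRatio r + y * sinRatio (r + 1)) := by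
  have h1 := zeta_pow_eq r
  have h2 := zeta_pow_eq (r + 1)
  have h3 := zeta_pow_add r 1
  rw [add_sub_cancel_right] at h2
  simp only [Fin.val_one, pow_one] at h3
  simp only [vec, map_neg, map_add, map_mul]
  push_cast
  linear_combination (val x : ℝ) * h1 + (val y : ℝ) * h2 - (val y : ℝ) * h3

/-- The coordinates of the point `x + y ζ`; they lie in `ℤ[√2]`. -/
def vecCoord (x y : ℤ√2) (k : Fin 8) : ℤ√2 := x * twoCos k + y * twoCos (k - 1)

theorem coord_one (k : Fin 8) : coord k 1 = val (twoCos k) := by simp [coord]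

theorem coord_vec (x y : ℤ√2) (k : Fin 8) : coord k (vec x y) = val (vecCoord x y k) := by
  have h : vec x y = (val x : ℝ) * 1 + (val y : ℝ) * (zeta * 1) := by simp [vec]
  rw [h, coord_add, coord_real_mul, coord_real_mul, coord_zeta_mul, coord_one, coord_one]
  simp [vecCoord]

/-- The points on none of the countably many lines `coord k p = x` with `x` in `ℤ[√2]`. They are
never on the boundary of a piece. -/
def Generic (p : ℂ) : Prop := ∀ (k : Fin 8) (x : ℤ√2), coord k p ≠ val x

/-! ### Polygons with sides in the eight directions -/

/-- A system of octagonal constraints `coord k p < c k`, one for each of the eight directions. It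
describes an open convex polygon; some constraints may be redundant. -/
abbrev Octagonal := Fin 8 → ℤ√2

/-- The points that satisfy a system of octagonal constraints. -/
def Mem (c : Octagonal) (p : ℂ) : Prop := ∀ k, coord k p < val (c k)

/-- The eight directions, as a list. -/
def dirs : List (Fin 8) := [0, 1, 2, 3, 4, 5, 6, 7]

theorem mem_dirs (k : Fin 8) : k ∈ dirs := by revert k; decide

/-- Sufficient condition for a system of octagonal constraints to be contradictory: two opposite
constraints, or three constraints related by `coord_dependence`, exclude each other. -/
def isEmpty (c : Octagonal) : Bool :=
  dirs.any fun k => isNonneg (-(c k + c (k + 4))) || isNonneg (-(rt * c k + c (k + 3) + c (k + 5)))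

theorem isEmpty_sound {c : Octagonal} (h : isEmpty c = true) {p : ℂ} : ¬ Mem c p := by
  intro hp
  simp only [isEmpty, List.any_eq_true, Bool.or_eq_true] at h
  obtain ⟨k, -, hk | hk⟩ := h
  · have := isNonneg_sound hk
    have h1 := hp k
    have h2 := hp (k + 4)
    rw [coord_add_four] at h2
    simp only [map_neg, map_add] at this
    linarith
  · have := isNonneg_sound hk
    have h1 := hp k
    have h2 := hp (k + 3)
    have h3 := hp (k + 5)
    have h4 := coord_dependence k p
    have hr : val rt = √2 := by simp [val_apply, rt]
    have h5 : √2 * coord k p < √2 * val (c k) := by gcongr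
    simp only [map_neg, map_add, map_mul, hr] at this
    linarith

/-- The constraints `c`, with the one in direction `k` replaced by `coord k p < b`. -/
def clip (c : Octagonal) (k : Fin 8) (b : ℤ√2) : Octagonal := fun j => if j = k then b else c j

theorem mem_clip {c : Octagonal} {k : Fin 8} {b : ℤ√2} {p : ℂ} (hp : Mem c p)
    (hk : coord k p < val b) : Mem (clip c k b) p := by
  intro j
  rw [clip]
  split_ifs with h
  · rwa [h]
  · exact hp j

theorem mem_clip_opposite {c : Octagonal} {k : Fin 8} {b : ℤ√2} {p : ℂ} (hg : Generic p)
    (hp : Mem c p) (hk : ¬ coord k p < val b) : Mem (clip c (k + 4) (-b)) p := by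
  refine mem_clip hp ?_
  have := lt_of_le_of_ne (not_lt.1 hk) (hg k b).symm
  rw [coord_add_four, map_neg]
  linarith

/-- Test whether `coord k p < b` follows from `c`, directly or because the opposite constraint
contradicts `c`. -/
def below (c : Octagonal) (k : Fin 8) (b : ℤ√2) : Bool :=
  isNonneg (b - c k) || isEmpty (clip c (k + 4) (-b))

theorem below_sound {c : Octagonal} {k : Fin 8} {b : ℤ√2} (h : below c k b = true) {p : ℂ}
    (hg : Generic p) (hp : Mem c p) : coord k p < val b := by
  by_contra hk
  simp only [below, Bool.or_eq_true] at h
  rcases h with h | h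
  · have := isNonneg_sound h
    rw [map_sub] at this
    linarith [hp k]
  · exact isEmpty_sound h (mem_clip_opposite hg hp hk)

/-- Test whether the polygon `c` lies in the polygon `d`. -/
def isSubset (c d : Octagonal) : Bool := dirs.all fun k => below c k (d k)

theorem isSubset_sound {c d : Octagonal} (h : isSubset c d = true) {p : ℂ}
    (hg : Generic p) (hp : Mem c p) : Mem d p := fun k =>
  below_sound (List.all_eq_true.1 h k (mem_dirs k)) hg hp

/-- The intersection of two polygons. -/
def inter (c d : Octagonal) : Octagonal := fun k => if isNonneg (d k - c k) then c k else d k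

theorem mem_inter {c d : Octagonal} {p : ℂ} (hc : Mem c p) (hd : Mem d p) :
    Mem (inter c d) p := by
  intro k
  rw [inter]
  split_ifs
  exacts [hc k, hd k]

/-- Polygons that cover the part of `c` outside the half-planes of `d` with directions in a list. -/
def cut (d : Octagonal) : List (Fin 8) → Octagonal → List Octagonal
  | [], _ => []
  | k :: ks, c =>
    if isNonneg (d k - c k) then cut d ks c else
      if isEmpty (clip c (k + 4) (-(d k))) then cut d ks (clip c k (d k)) else
        clip c (k + 4) (-(d k)) :: cut d ks (clip c k (d k))

theorem cut_sound {d : Octagonal} {p : ℂ} (hg : Generic p) :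
    ∀ (ks : List (Fin 8)) (c : Octagonal), Mem c p → (∃ k ∈ ks, ¬ coord k p < val (d k)) →
      ∃ c' ∈ cut d ks c, Mem c' p := by
  intro ks
  induction ks with
  | nil => rintro c - ⟨k, hk, -⟩; simp at hk
  | cons k ks ih =>
    intro c hp hk
    by_cases hlt : coord k p < val (d k)
    · have hks : ∃ j ∈ ks, ¬ coord j p < val (d j) := by
        obtain ⟨j, hj, hj'⟩ := hk
        rcases List.mem_cons.1 hj with rfl | hj
        · exact absurd hlt hj'
        · exact ⟨j, hj, hj'⟩
      rw [cut]
      split_ifs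
      · exact ih c hp hks
      · exact ih _ (mem_clip hp hlt) hks
      · obtain ⟨c', hc', h⟩ := ih _ (mem_clip hp hlt) hks
        exact ⟨c', List.mem_cons_of_mem _ hc', h⟩
    · have hout := mem_clip_opposite hg hp hlt
      rw [cut]
      split_ifs with h1 h2
      · have := isNonneg_sound h1
        rw [map_sub] at this
        linarith [hp k]
      · exact absurd hout (isEmpty_sound h2)
      · exact ⟨_, List.mem_cons_self, hout⟩

/-- Polygons that cover the part of `c` outside `d`. -/
def diff (d c : Octagonal) : List Octagonal := if isEmpty (inter c d) then [c] else cut d dirs c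

theorem diff_sound {c d : Octagonal} {p : ℂ} (hg : Generic p) (hc : Mem c p) (hd : ¬ Mem d p) :
    ∃ c' ∈ diff d c, Mem c' p := by
  rw [diff]
  split_ifs
  · exact ⟨c, List.mem_singleton_self c, hc⟩
  · obtain ⟨k, hk⟩ := not_forall.1 hd
    exact cut_sound hg _ c hc ⟨k, mem_dirs k, hk⟩

/-- Test whether `c` is covered by a list of polygons, up to boundary lines: the polygons of the
list are removed from `c` one after the other, and nothing may remain. -/
def cover (c : Octagonal) (l : List Octagonal) : Bool :=
  (l.foldl (fun cs d => cs.flatMap (diff d)) [c]).isEmpty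

theorem cover_sound {c : Octagonal} {l : List Octagonal} (h : cover c l = true) {p : ℂ}
    (hg : Generic p) (hp : Mem c p) : ∃ d ∈ l, Mem d p := by
  by_contra! hl
  have key : ∀ (l : List Octagonal) (cs : List Octagonal), (∀ d ∈ l, ¬ Mem d p) →
      (∃ c ∈ cs, Mem c p) → ∃ c ∈ l.foldl (fun cs d => cs.flatMap (diff d)) cs, Mem c p := by
    intro l
    induction l with
    | nil => intro cs _ h; exact h
    | cons d l ih =>
      rintro cs hd ⟨c, hc, hcp⟩
      obtain ⟨c', hc', hcp'⟩ := diff_sound hg hcp (hd d List.mem_cons_self)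
      exact ih _ (fun e he => hd e (List.mem_cons_of_mem _ he))
        ⟨c', List.mem_flatMap.2 ⟨c, hc, hc'⟩, hcp'⟩
  obtain ⟨c', hc', -⟩ := key l [c] hl ⟨c, List.mem_singleton_self c, hp⟩
  rw [cover, List.isEmpty_iff] at h
  rw [h] at hc'
  simp at hc'

/-! ### Similarities -/

/-- The orientation preserving similarity `p ↦ (√2 - 1) ^ e * ζ ^ r * p + (x + y ζ)`. It and its
inverse preserve the lines `coord k p = x` with `x` in `ℤ[√2]`, since `√2 - 1` is a unit. -/
structure Sim where
  e : ℕ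
  r : Fin 8
  x : ℤ√2
  y : ℤ√2

/-- The action of a similarity on the plane. -/
noncomputable def Sim.act (g : Sim) (p : ℂ) : ℂ :=
  (val (lam g.e) : ℝ) * (zeta ^ (g.r : ℕ) * p) + vec g.x g.y

/-- Equality test for similarities. -/
def Sim.same (g h : Sim) : Bool :=
  decide (g.e = h.e) && decide (g.r = h.r) && decide (g.x.re = h.x.re) &&
  decide (g.x.im = h.x.im) && decide (g.y.re = h.y.re) && decide (g.y.im = h.y.im)

theorem same_sound {g h : Sim} (H : g.same h = true) : g = h := by
  obtain ⟨e, r, ⟨a, b⟩, ⟨c, d⟩⟩ := g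
  obtain ⟨e', r', ⟨a', b'⟩, ⟨c', d'⟩⟩ := h
  simp only [Sim.same, Bool.and_eq_true, decide_eq_true_eq] at H
  obtain ⟨⟨⟨⟨⟨rfl, rfl⟩, rfl⟩, rfl⟩, rfl⟩, rfl⟩ := H
  rfl

/-- The composition of two similarities. -/
def Sim.comp (g h : Sim) : Sim :=
  ⟨g.e + h.e, g.r + h.r,
    lam g.e * -(h.x * sinRatio (g.r - 1) + h.y * sinRatio g.r) + g.x,
    lam g.e * (h.x * sinRatio g.r + h.y * sinRatio (g.r + 1)) + g.y⟩

theorem comp_act (g h : Sim) (p : ℂ) : (g.comp h).act p = g.act (h.act p) := by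
  have h1 := vec_rotate g.r h.x h.y
  have h2 := zeta_pow_add g.r h.r
  simp only [Sim.act, Sim.comp, lam_add, h2]
  simp only [vec, map_neg, map_add, map_mul] at h1 ⊢
  push_cast at h1 ⊢
  linear_combination -((val (lam g.e) : ℝ) : ℂ) * h1

/-- The identity. -/
def idSim : Sim := ⟨0, 0, 0, 0⟩

theorem idSim_act (p : ℂ) : idSim.act p = p := by
  simp [idSim, Sim.act, lam, vec]

/-- Translation by `x + y ζ`. -/
def translation (x y : ℤ√2) : Sim := ⟨0, 0, x, y⟩

theorem translation_act (x y : ℤ√2) (p : ℂ) : (translation x y).act p = p + vec x y := by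
  simp [translation, Sim.act, lam]

/-- The image of a polygon under a similarity. -/
def Sim.image (g : Sim) (c : Octagonal) : Octagonal :=
  fun k => lam g.e * c (k - g.r) + vecCoord g.x g.y k

theorem coord_act (g : Sim) (k : Fin 8) (p : ℂ) :
    coord k (g.act p) = val (lam g.e) * coord (k - g.r) p + val (vecCoord g.x g.y k) := by
  rw [Sim.act, coord_add, coord_real_mul, coord_rotate, coord_vec]

theorem mem_image_act {g : Sim} {c : Octagonal} {p : ℂ} :
    Mem (g.image c) (g.act p) ↔ Mem c p := by
  have h (k : Fin 8) : coord k (g.act p) < val (g.image c k) ↔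
      coord (k - g.r) p < val (c (k - g.r)) := by
    rw [coord_act, Sim.image, map_add, map_mul, add_lt_add_iff_right,
      mul_lt_mul_iff_right₀ (lam_pos _)]
  refine ⟨fun hp k => ?_, fun hp k => (h k).2 (hp _)⟩
  have := (h (k + g.r)).1 (hp _)
  rwa [add_sub_cancel_right] at this

theorem generic_act {g : Sim} {p : ℂ} : Generic (g.act p) ↔ Generic p := by
  constructor
  · intro h k x hx
    apply h (k + g.r) (lam g.e * x + vecCoord g.x g.y (k + g.r))
    rw [coord_act, add_sub_cancel_right, hx, map_add, map_mul]
  · intro h k x hx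
    obtain ⟨u, hu⟩ := lam_unit g.e
    apply h (k - g.r) (u * (x - vecCoord g.x g.y k))
    rw [coord_act] at hx
    have hu' : val (lam g.e) * val u = 1 := by rw [← map_mul, hu, map_one]
    rw [map_mul, map_sub, ← hx]
    linear_combination -(coord (k - g.r) p) * hu'

theorem generic_add_vec {x y : ℤ√2} {p : ℂ} : Generic (p + vec x y) ↔ Generic p := by
  rw [← translation_act, generic_act]

theorem act_surjective (g : Sim) : Function.Surjective g.act := by
  intro q
  have h1 : ((val (lam g.e) : ℝ) : ℂ) ≠ 0 := by exact_mod_cast (lam_pos g.e).ne'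
  have h2 : zeta ^ (g.r : ℕ) ≠ 0 := pow_ne_zero _ zeta_ne_zero
  refine ⟨(zeta ^ (g.r : ℕ))⁻¹ * ((val (lam g.e) : ℝ) : ℂ)⁻¹ * (q - vec g.x g.y), ?_⟩
  rw [Sim.act]
  field_simp
  ring

theorem act_injective (g : Sim) : Function.Injective g.act := by
  intro p q h
  have h1 : ((val (lam g.e) : ℝ) : ℂ) ≠ 0 := by exact_mod_cast (lam_pos g.e).ne'
  have h2 : zeta ^ (g.r : ℕ) ≠ 0 := pow_ne_zero _ zeta_ne_zero
  exact mul_left_cancel₀ h2 (mul_left_cancel₀ h1 (add_right_cancel h))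

theorem volume_affine (a b : ℂ) (s : Set ℂ) :
    volume ((fun z => a * z + b) '' s) = ENNReal.ofReal (‖a‖ ^ 2) * volume s := by
  have h : (fun z => a * z + b) '' s = (fun z => z + b) '' (LinearMap.mulLeft ℝ a '' s) := by
    rw [Set.image_image]
    rfl
  rw [h, Set.image_add_right, measure_preimage_add_right, Measure.addHaar_image_linearMap]
  have hd : LinearMap.det (LinearMap.mulLeft ℝ a) = Complex.normSq a := by
    rw [← Algebra.norm_complex_apply, Algebra.norm_apply]
    rfl
  rw [hd, abs_of_nonneg (Complex.normSq_nonneg a), Complex.normSq_eq_norm_sq]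

theorem volume_act_image (g : Sim) (s : Set ℂ) :
    volume (g.act '' s) = ENNReal.ofReal (val (lam g.e) ^ 2) * volume s := by
  have h : g.act = fun z => ((val (lam g.e) : ℝ) * zeta ^ (g.r : ℕ)) * z + vec g.x g.y := by
    ext z; rw [Sim.act, mul_assoc]
  rw [h, volume_affine, norm_mul, norm_pow, norm_zeta, one_pow, mul_one, Complex.norm_real,
    Real.norm_eq_abs, sq_abs]

theorem volume_act_image_eq_zero (g : Sim) {s : Set ℂ} (hs : volume s = 0) :
    volume (g.act '' s) = 0 := by
  rw [volume_act_image, hs, mul_zero]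

/-! ### Piecewise isometries and their return maps -/

/-- A piecewise isometry, as a list of polygons, each with the map that applies there. The maps used
below have exponent `e = 0`. -/
abbrev Pieces := List (Octagonal × Sim)

/-- One step of a piecewise isometry, from a generic point. -/
def Step (M : Pieces) (p q : ℂ) : Prop := Generic p ∧ ∃ m ∈ M, Mem m.1 p ∧ q = m.2.act p

/-- The point `p` comes back to itself after one or more steps of the relation `R`. -/
def Recurs (R : ℂ → ℂ → Prop) (p : ℂ) : Prop := Relation.TransGen R p p

theorem recurs_mono {R R' : ℂ → ℂ → Prop} (h : ∀ p q, R p q → Relation.TransGen R' p q) {p : ℂ}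
    (hp : Recurs R p) : Recurs R' p := Relation.TransGen.closed h p p hp

/-- Test whether the orbit of the polygon `a.image c` under `M` goes, in at most `n` steps and without
being cut, through a position where the composed map is `t`. The polygon `c` stays fixed in the
recursion, and `a` is the similarity that takes it to the present position. -/
def chain (M : Pieces) (t : Sim) : ℕ → Octagonal → Sim → Bool
  | 0, _, _ => false
  | n + 1, c, a => M.any fun m => isSubset (a.image c) m.1 &&
      ((m.2.comp a).same t || chain M t n c (m.2.comp a))

theorem chain_sound {M : Pieces} {t : Sim} : ∀ {n : ℕ} {c : Octagonal} {a : Sim},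
    chain M t n c a = true → ∀ {p : ℂ}, Generic p → Mem c p →
      Relation.TransGen (Step M) (a.act p) (t.act p) := by
  intro n
  induction n with
  | zero => intro c a h; simp [chain] at h
  | succ n ih =>
    intro c a h p hg hp
    simp only [chain, List.any_eq_true, Bool.and_eq_true, Bool.or_eq_true] at h
    obtain ⟨m, hm, hsub, h⟩ := h
    have hg' := generic_act (g := a).2 hg
    have hstep : Step M (a.act p) ((m.2.comp a).act p) :=
      ⟨hg', m, hm, isSubset_sound hsub hg' (mem_image_act.2 hp), comp_act _ _ _⟩
    rcases h with h | h
    · rw [same_sound h] at hstep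
      exact .single hstep
    · exact .head hstep (ih h hg hp)

theorem recurs_of_chain {M : Pieces} {n : ℕ} {c : Octagonal}
    (h : chain M idSim n c idSim = true) {p : ℂ} (hg : Generic p) (hp : Mem c p) :
    Recurs (Step M) p := by
  have := chain_sound h hg hp
  rwa [idSim_act] at this

/-- Test whether iterates of `M` on the `φ`-image of the domain of `M'` are conjugate to `M'` by `φ`:
on the image of each piece of `M'`, some iterate of `M` (by at most `n` steps) acts as `M'` does on
the piece. -/
def returnsConj (M M' : Pieces) (n : ℕ) (φ : Sim) : Bool :=
  M'.all fun m => chain M (φ.comp m.2) n m.1 φ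

/-- A point that is periodic for `M'` has an image under `φ` that is periodic for `M`. -/
theorem recurs_act {M M' : Pieces} {n : ℕ} {φ : Sim} (h : returnsConj M M' n φ = true) {p : ℂ}
    (hp : Recurs (Step M') p) : Recurs (Step M) (φ.act p) := by
  refine Relation.TransGen.lift' φ.act ?_ p p hp
  rintro x y ⟨hg, m, hm, hx, rfl⟩
  have := chain_sound (List.all_eq_true.1 h m hm) hg hx
  rwa [comp_act] at this

/-! ### The base region and its self-similarity -/

/-- The branches of the billiard in the wedge: `move j` is `z ↦ ζ ^ j * (z - v) - v`, where
`v = -1 + (1 + √2) i` is the vertex of the octagon at the apex of the wedge. -/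
def move : Fin 4 → Sim :=
  ![⟨0, 0, ⟨4, 2⟩, ⟨-4, -2⟩⟩, ⟨0, 1, ⟨4, 2⟩, ⟨-2, -2⟩⟩, ⟨0, 2, ⟨2, 2⟩, ⟨-2, 0⟩⟩, ⟨0, 3, ⟨2, 0⟩, ⟨0, 0⟩⟩]

/-- The part of the base region at the apex, a right triangle; `move 3` applies there. -/
def apexTriangle : Octagonal := ![⟨0, 2⟩, ⟨4, 0⟩, ⟨0, 2⟩, ⟨0, 0⟩, ⟨0, 0⟩, ⟨0, 0⟩, ⟨0, 0⟩, ⟨2, 0⟩]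

/-- The left part of the kite in the base region where `move 2` applies. The kite is divided by a
vertical line, since iterates of `piecesG` act differently on its two parts. -/
def kiteLeft : Octagonal := ![⟨4, 2⟩, ⟨4, 2⟩, ⟨2, 2⟩, ⟨0, 0⟩, ⟨0, -2⟩, ⟨-2, 0⟩, ⟨0, 0⟩, ⟨2, 2⟩]

/-- The right part of the kite in the base region where `move 2` applies. -/
def kiteRight : Octagonal := ![⟨4, 4⟩, ⟨4, 2⟩, ⟨0, 2⟩, ⟨0, -2⟩, ⟨-4, -2⟩, ⟨-2, -2⟩, ⟨0, 0⟩, ⟨4, 2⟩]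

/-- The triangle in the base region where `move 1` applies. -/
def cutTriangle : Octagonal := ![⟨4, 2⟩, ⟨4, 4⟩, ⟨4, 2⟩, ⟨0, 0⟩, ⟨-2, -2⟩, ⟨-4, -2⟩, ⟨0, -2⟩, ⟨0, 2⟩]

/-- The base region: the part of the wedge to the left of `stripOctagon`, divided into four
polygons. -/
def base : List Octagonal := [apexTriangle, kiteLeft, kiteRight, cutTriangle]

/-- The billiard on the base region. -/
def piecesF : Pieces :=
  [(apexTriangle, move 3), (kiteLeft, move 2), (kiteRight, move 2), (cutTriangle, move 1)]

/-- The companion of `piecesF` on the base region: the return map of `piecesF` to each of the three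
small copies of the base region, rescaled. -/
def piecesG : Pieces :=
  [(apexTriangle, ⟨0, 3, ⟨2, 2⟩, ⟨0, 0⟩⟩), (cutTriangle, ⟨0, 3, ⟨2, 2⟩, ⟨0, 0⟩⟩),
   (kiteLeft, ⟨0, 3, ⟨2, 2⟩, ⟨0, 0⟩⟩),
   (![⟨6, 2⟩, ⟨4, 2⟩, ⟨0, 2⟩, ⟨0, -2⟩, ⟨-4, -2⟩, ⟨-2, -2⟩, ⟨0, 0⟩, ⟨0, 4⟩], ⟨0, 4, ⟨4, 0⟩, ⟨4, 0⟩⟩),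
   (![⟨4, 4⟩, ⟨4, 2⟩, ⟨-2, 2⟩, ⟨0, -4⟩, ⟨-8, 0⟩, ⟨0, -4⟩, ⟨0, 0⟩, ⟨4, 2⟩], ⟨0, 5, ⟨0, 0⟩, ⟨6, 2⟩⟩)]

/-- The octagon in the base region that is rotated by `piecesF` and by `piecesG`. -/
def baseOctagon : Octagonal := ![⟨4, 2⟩, ⟨4, 2⟩, ⟨4, 0⟩, ⟨0, 0⟩, ⟨0, -2⟩, ⟨0, -2⟩, ⟨0, 0⟩, ⟨4, 0⟩]

/-- The similarities, of ratio `√2 - 1`, from the base region to its three small copies. -/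
def contractions : List Sim := [⟨1, 0, 0, 0⟩, ⟨1, 3, ⟨2, 2⟩, 0⟩, ⟨1, 5, 0, ⟨2, 2⟩⟩]

/-- The polygons that make up the images of the base region under some similarities. -/
def images (l : List Sim) : List Octagonal := l.flatMap fun φ => base.map φ.image

theorem mem_images {l : List Sim} {d : Octagonal} :
    d ∈ images l ↔ ∃ φ ∈ l, ∃ c ∈ base, φ.image c = d := by
  simp [images, List.mem_flatMap]

theorem contractions_conj_F :
    (contractions.all fun φ => returnsConj piecesF piecesG 13 φ) = true := by decide +kernel

theorem contractions_conj_G :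
    (contractions.all fun φ => returnsConj piecesG piecesF 3 φ) = true := by decide +kernel

theorem baseOctagon_recurs_F : chain piecesF idSim 4 baseOctagon idSim = true := by decide +kernel

theorem baseOctagon_recurs_G : chain piecesG idSim 8 baseOctagon idSim = true := by decide +kernel

theorem base_cover :
    (base.all fun c => cover c (baseOctagon :: images contractions)) = true := by decide +kernel

/-- The generic points of the base region that are not periodic for the piecewise isometry `M`. -/
def wandering (M : Pieces) : Set ℂ :=
  {p | Generic p ∧ (∃ c ∈ base, Mem c p) ∧ ¬ Recurs (Step M) p}

theorem wandering_subset {M M' : Pieces} {n k : ℕ}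
    (hoct : chain M idSim k baseOctagon idSim = true)
    (hconj : (contractions.all fun φ => returnsConj M M' n φ) = true) :
    wandering M ⊆ ⋃ φ ∈ contractions, φ.act '' wandering M' := by
  rintro p ⟨hg, ⟨c, hc, hp⟩, hrec⟩
  obtain ⟨d, hd, hdp⟩ := cover_sound (List.all_eq_true.1 base_cover c hc) hg hp
  rcases List.mem_cons.1 hd with rfl | hd
  · exact absurd (recurs_of_chain hoct hg hdp) hrec
  · obtain ⟨φ, hφ, c', hc', rfl⟩ := mem_images.1 hd
    obtain ⟨q, rfl⟩ := act_surjective φ p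
    refine Set.mem_biUnion hφ ⟨q, ⟨generic_act.1 hg, ⟨c', hc', mem_image_act.1 hdp⟩, ?_⟩, rfl⟩
    exact fun h => hrec (recurs_act (List.all_eq_true.1 hconj φ hφ) h)

/-- The constant is `9 - 6 √2 = 3 (√2 - 1)²`. -/
theorem volume_wandering_le {M M' : Pieces} {n k : ℕ}
    (hoct : chain M idSim k baseOctagon idSim = true)
    (hconj : (contractions.all fun φ => returnsConj M M' n φ) = true) :
    volume (wandering M) ≤ ENNReal.ofReal (9 - 6 * √2) * volume (wandering M') := by
  have hsq : val (lam 1) ^ 2 = 3 - 2 * √2 := by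
    simp only [lam, mul_one, val_apply]
    push_cast
    linear_combination sqrt_two_sq
  have hpos : 0 ≤ 3 - 2 * √2 := hsq ▸ sq_nonneg _
  have h3 : (9 - 6 * √2 : ℝ) = (3 - 2 * √2) + ((3 - 2 * √2) + (3 - 2 * √2)) := by ring
  calc volume (wandering M)
      ≤ volume (⋃ φ ∈ contractions, φ.act '' wandering M') :=
        measure_mono (wandering_subset hoct hconj)
    _ ≤ _ := by
      simp only [contractions, List.mem_cons, List.not_mem_nil, or_false,
        Set.iUnion_iUnion_eq_or_left,
        Set.iUnion_iUnion_eq_left]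
      refine (measure_union_le _ _).trans ?_
      rw [h3, ENNReal.ofReal_add hpos (by linarith), add_mul, ENNReal.ofReal_add hpos hpos, add_mul]
      refine add_le_add ?_ ((measure_union_le _ _).trans (add_le_add ?_ ?_))
      all_goals exact (volume_act_image _ _).le.trans_eq (by rw [hsq])

theorem volume_wandering_lt_top (M : Pieces) : volume (wandering M) < ⊤ := by
  refine lt_of_le_of_lt (measure_mono (t := Metric.closedBall 0 40) ?_)
    measure_closedBall_lt_top
  rintro p ⟨hg, ⟨c, hc, hp⟩, -⟩
  have hb : (base.all fun c => dirs.all fun k => isNonneg (⟨40, 0⟩ - c k)) = true := by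
    decide +kernel
  have hb' (k : Fin 8) : coord k p < 40 := by
    have := isNonneg_sound (List.all_eq_true.1 (List.all_eq_true.1 hb c hc) k (mem_dirs k))
    have h40 : val ⟨40, 0⟩ = 40 := by simp [val_apply]
    rw [map_sub, h40] at this
    linarith [hp k]
  have h0 := hb' 0
  have h2 := hb' 2
  have h4 := hb' 4
  have h6 := hb' 6
  simp [coord, twoCos, val_apply] at h0 h2 h4 h6
  rw [mem_closedBall_zero_iff]
  refine (Complex.norm_le_abs_re_add_abs_im p).trans ?_
  have h1 : |p.re| ≤ 20 := abs_le.2 ⟨by linarith, by linarith⟩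
  have h2 : |p.im| ≤ 20 := abs_le.2 ⟨by linarith, by linarith⟩
  linarith

theorem volume_wandering_F : volume (wandering piecesF) = 0 := by
  have h1 := volume_wandering_le baseOctagon_recurs_F contractions_conj_F
  have h2 := volume_wandering_le baseOctagon_recurs_G contractions_conj_G
  have hlt : ENNReal.ofReal (9 - 6 * √2) < 1 := by
    rw [ENNReal.ofReal_lt_one]
    have : (4 / 3 : ℝ) < √2 := by rw [Real.lt_sqrt] <;> norm_num
    linarith
  set q := ENNReal.ofReal (9 - 6 * √2)
  by_contra h0
  have hfin := (volume_wandering_lt_top piecesF).ne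
  have hqq : q * q < 1 := by
    calc q * q ≤ q * 1 := by gcongr
      _ < 1 := by rwa [mul_one]
  have h3 : volume (wandering piecesF) ≤ q * q * volume (wandering piecesF) := by
    rw [mul_assoc]
    exact h1.trans (by gcongr)
  have h4 : q * q * volume (wandering piecesF) < 1 * volume (wandering piecesF) :=
    (ENNReal.mul_lt_mul_iff_left h0 hfin).2 hqq
  rw [one_mul] at h4
  exact absurd h3 h4.not_ge

/-! ### The billiard in the wedge -/

/-- The open wedge `0 < im z < re z`. -/
def Wedge (z : ℂ) : Prop := coord 6 z < 0 ∧ coord 3 z < 0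

/-- One step of the billiard in the wedge. At most one `j` keeps a point in the wedge, but this is
not needed: each such `j` gives the same point of the plane up to a rotation of the octagon. -/
def StepW (p q : ℂ) : Prop := Wedge p ∧ Wedge q ∧ ∃ j, q = (move j).act p

theorem step_F_le_stepW {p q : ℂ} (h : Step piecesF p q) : StepW p q := by
  obtain ⟨hg, m, hm, hp, rfl⟩ := h
  have hcheck : (piecesF.all fun m => below m.1 6 0 && below m.1 3 0 &&
      below (m.2.image m.1) 6 0 && below (m.2.image m.1) 3 0) = true := by decide +kernel
  have h := List.all_eq_true.1 hcheck m hm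
  simp only [Bool.and_eq_true] at h
  obtain ⟨⟨⟨h1, h2⟩, h3⟩, h4⟩ := h
  have hg' := generic_act (g := m.2).2 hg
  have hp' := mem_image_act (g := m.2).2 hp
  have e1 := below_sound h1 hg hp
  have e2 := below_sound h2 hg hp
  have e3 := below_sound h3 hg' hp'
  have e4 := below_sound h4 hg' hp'
  rw [map_zero] at e1 e2 e3 e4
  refine ⟨⟨e1, e2⟩, ⟨e3, e4⟩, ?_⟩
  simp only [piecesF, List.mem_cons, List.not_mem_nil, or_false] at hm
  rcases hm with rfl | rfl | rfl | rfl
  exacts [⟨3, rfl⟩, ⟨2, rfl⟩, ⟨2, rfl⟩, ⟨1, rfl⟩]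

theorem recurs_stepW_of_F {p : ℂ} (h : Recurs (Step piecesF) p) : Recurs StepW p :=
  recurs_mono (fun _ _ h => .single (step_F_le_stepW h)) h

/-- The image of the wedge under `move j` is bounded by two lines through the image of the apex. -/
theorem coord_move_lt {j : Fin 4} {p : ℂ} {k : Fin 8} (h : coord k p < 0) :
    coord (k + (move j).r) ((move j).act p) <
      val (vecCoord (move j).x (move j).y (k + (move j).r)) := by
  have hl : val (lam (move j).e) = 1 := by fin_cases j <;> simp [move, lam]
  rw [coord_act, add_sub_cancel_right, hl]
  linarith

/-- The billiard in the wedge is injective. -/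
theorem stepW_injective {p p' q : ℂ} (h : StepW p q) (h' : StepW p' q) : p = p' := by
  obtain ⟨hp, hq, j, hj⟩ := h
  obtain ⟨hp', -, j', hj'⟩ := h'
  -- for `j ≠ j'` the images of the wedge under `move j` and `move j'` are disjoint within it
  by_cases hjj : j = j'
  · subst hjj
    exact act_injective _ (hj.symm.trans hj')
  exfalso
  have a1 := coord_move_lt (j := j) hp.1
  have a2 := coord_move_lt (j := j) hp.2
  have b1 := coord_move_lt (j := j') hp'.1
  have b2 := coord_move_lt (j := j') hp'.2
  rw [← hj] at a1 a2
  rw [← hj'] at b1 b2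
  obtain ⟨c1, c2⟩ := hq
  clear hj hj' hp hp'
  have hs := sqrt_two_sq
  have hs0 : 0 < √2 := by positivity
  fin_cases j <;> fin_cases j' <;> try exact hjj rfl
  all_goals
    simp [move, vecCoord, twoCos, coord, val_apply] at a1 a2 b1 b2 c1 c2
    nlinarith

theorem recurs_of_stepW {p q : ℂ} (h : StepW p q) (hq : Recurs StepW q) : Recurs StepW p := by
  obtain ⟨r, hr, hrq⟩ := Relation.TransGen.tail'_iff.1 hq
  rw [← stepW_injective h hrq] at hr
  exact .head' h hr

/-- The displacement of the translation `move 0`. -/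
noncomputable def descent : ℂ := vec ⟨4, 2⟩ ⟨-4, -2⟩

theorem move_zero_act (p : ℂ) : (move 0).act p = p + descent := translation_act _ _ p

theorem coord_add_descent (z : ℂ) (n : ℕ) :
    coord 6 (z + n * descent) = coord 6 z + n * (4 + 4 * √2) ∧
    coord 3 (z + n * descent) = coord 3 z - n * (4 + 4 * √2) := by
  have h (k : Fin 8) : coord k (z + n * descent) =
      coord k z + n * val (vecCoord ⟨4, 2⟩ ⟨-4, -2⟩ k) := by
    have := coord_real_mul k n descent
    rw [coord_add]
    push_cast at this
    rw [this, descent, coord_vec]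
  have h6 : vecCoord ⟨4, 2⟩ ⟨-4, -2⟩ 6 = ⟨4, 4⟩ := by decide
  have h3 : vecCoord ⟨4, 2⟩ ⟨-4, -2⟩ 3 = ⟨-4, -4⟩ := by decide
  rw [h, h, h6, h3, val_apply, val_apply]
  push_cast
  constructor <;> ring

/-- As long as it stays in the wedge, the translation `move 0` can be iterated. -/
theorem wedge_add_descent {z : ℂ} {n i : ℕ} (hz : Wedge z) (hn : coord 6 (z + n * descent) < 0)
    (hi : i ≤ n) : Wedge (z + i * descent) := by
  have hi' : (i : ℝ) ≤ n := by exact_mod_cast hi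
  have hs := Real.sqrt_nonneg 2
  have h1 := coord_add_descent z n
  have h2 := coord_add_descent z i
  have h3 : (0 : ℝ) ≤ i * (4 + 4 * √2) := by positivity
  have h4 : (i : ℝ) * (4 + 4 * √2) ≤ n * (4 + 4 * √2) := by gcongr
  refine ⟨?_, ?_⟩
  · rw [h2.1]; rw [h1.1] at hn; linarith
  · rw [h2.2]; linarith [hz.2]

theorem stepW_add_descent {z : ℂ} {n i : ℕ} (hz : Wedge z) (hn : coord 6 (z + n * descent) < 0)
    (hi : i + 1 ≤ n) : StepW (z + i * descent) (z + (i + 1 : ℕ) * descent) := by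
  refine ⟨wedge_add_descent hz hn (by omega), wedge_add_descent hz hn hi, 0, ?_⟩
  rw [move_zero_act]
  push_cast
  ring

/-! ### The periodic structure of the strip -/

/-- The part of the strip `0 < im z < 2 + 2 √2` of the wedge where the billiard acts by `move 1`. -/
def Far (p : ℂ) : Prop :=
  coord 2 p < val ⟨4, 4⟩ ∧ coord 3 p < 0 ∧ coord 5 p < val ⟨-4, -2⟩ ∧ coord 6 p < 0

/-- First return to the strip, between points of its far part: `move 1`, and then the translation
`move 0` until the strip is reached. -/
def StepS (p q : ℂ) : Prop := Far p ∧ Far q ∧ ∃ n : ℕ, q = (move 1).act p + n * descent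

theorem wedge_move_one {p : ℂ} (h : Far p) : Wedge ((move 1).act p) := by
  have h6 : vecCoord (move 1).x (move 1).y 6 = ⟨4, 2⟩ := by decide
  have h3 : vecCoord (move 1).x (move 1).y 3 = ⟨-4, -4⟩ := by decide
  have e6 := coord_act (move 1) 6 p
  have e3 := coord_act (move 1) 3 p
  have hl : val (lam (move 1).e) = 1 := by simp [move, lam]
  have k6 : (6 : Fin 8) - (move 1).r = 5 := by decide
  have k3 : (3 : Fin 8) - (move 1).r = 2 := by decide
  rw [h6, hl, k6, val_apply] at e6
  rw [h3, hl, k3, val_apply] at e3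
  obtain ⟨h2, -, h5, -⟩ := h
  rw [val_apply] at h2 h5
  push_cast at *
  constructor <;> linarith

theorem transGen_of_stepS {p q : ℂ} (h : StepS p q) : Relation.TransGen StepW p q := by
  obtain ⟨hp, hq, n, rfl⟩ := h
  have hw := wedge_move_one hp
  have key : ∀ i ≤ n, Relation.TransGen StepW p ((move 1).act p + i * descent) := by
    intro i
    induction i with
    | zero =>
      intro _
      refine .single ⟨⟨hp.2.2.2, hp.2.1⟩, ?_, 1, ?_⟩ <;> simp [hw]
    | succ i ih => exact fun hi => .tail (ih (by omega)) (stepW_add_descent hw hq.2.2.2 hi)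
  exact key n le_rfl

/-- The period `4 + 2 √2` of the strip. -/
noncomputable def period : ℂ := vec ⟨4, 2⟩ 0

theorem far_add_period {p : ℂ} (h : Far p) : Far (p + period) := by
  have hs := Real.sqrt_nonneg 2
  have e (k : Fin 8) : coord k (p + period) = coord k p + val (vecCoord ⟨4, 2⟩ 0 k) := by
    rw [coord_add, period, coord_vec]
  obtain ⟨h2, h3, h5, h6⟩ := h
  have v2 : vecCoord ⟨4, 2⟩ 0 2 = 0 := by decide
  have v3 : vecCoord ⟨4, 2⟩ 0 3 = ⟨-4, -4⟩ := by decide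
  have v5 : vecCoord ⟨4, 2⟩ 0 5 = ⟨-4, -4⟩ := by decide
  have v6 : vecCoord ⟨4, 2⟩ 0 6 = 0 := by decide
  have hv : val ⟨-4, -4⟩ < 0 := by rw [val_apply]; push_cast; linarith
  refine ⟨?_, ?_, ?_, ?_⟩
  · rwa [e, v2, map_zero, add_zero]
  · rw [e, v3]; linarith
  · rw [e, v5]; linarith
  · rwa [e, v6, map_zero, add_zero]

/-- The reason for the value of the period: the rotation in `move 1` changes it by one step of
`move 0`. -/
theorem zeta_mul_period : zeta * period = period - descent := by
  have h := vec_rotate 1 ⟨4, 2⟩ 0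
  have e1 : -((⟨4, 2⟩ : ℤ√2) * sinRatio (1 - 1) + 0 * sinRatio 1) = 0 := by decide
  have e2 : (⟨4, 2⟩ : ℤ√2) * sinRatio 1 + 0 * sinRatio (1 + 1) = ⟨4, 2⟩ := by decide
  rw [e1, e2] at h
  simp only [Fin.val_one, pow_one] at h
  rw [period, h, descent]
  simp [vec, val_apply]
  ring

theorem stepS_add_period {p q : ℂ} (h : StepS p q) : StepS (p + period) (q + period) := by
  obtain ⟨hp, hq, n, rfl⟩ := h
  refine ⟨far_add_period hp, far_add_period hq, n + 1, ?_⟩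
  have h1 : (move 1).act (p + period) = (move 1).act p + zeta * period := by
    simp [Sim.act, move, lam]; ring
  rw [h1, zeta_mul_period]
  push_cast
  ring

theorem recurs_add_period {p : ℂ} (h : Recurs StepS p) (n : ℕ) :
    Recurs StepS (p + n * period) := by
  induction n with
  | zero => simpa using h
  | succ n ih =>
    have := Relation.TransGen.lift (· + period) (fun _ _ => stepS_add_period) _ _ ih
    have e : p + (n + 1 : ℕ) * period = p + n * period + period := by push_cast; ring
    rw [Recurs, e]
    exact this

/-- Two pieces of the first return map to the strip, with no or one step of `move 0` after `move 1`. -/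
def piecesS : Pieces :=
  [(![⟨12, 8⟩, ⟨8, 6⟩, ⟨4, 4⟩, ⟨0, 0⟩, ⟨-4, -2⟩, ⟨-4, -2⟩, ⟨0, 0⟩, ⟨8, 6⟩], ⟨0, 1, ⟨4, 2⟩, ⟨-2, -2⟩⟩),
   (![⟨20, 12⟩, ⟨12, 10⟩, ⟨4, 4⟩, ⟨0, -2⟩, ⟨-8, -4⟩, ⟨-8, -6⟩, ⟨0, 0⟩, ⟨12, 10⟩], ⟨0, 1, ⟨8, 4⟩, ⟨-6, -4⟩⟩)]

/-- The octagon of side `2` in the strip that is next to the apex; `move 1` rotates it. -/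
def stripOctagon : Octagonal := ![⟨8, 6⟩, ⟨8, 6⟩, ⟨4, 4⟩, ⟨0, 0⟩, ⟨-4, -2⟩, ⟨-4, -2⟩, ⟨0, 0⟩, ⟨4, 4⟩]

/-- The isometries from the base region to the two copies of it between `stripOctagon` and its
translate by the period. -/
def gapCopies : List Sim := [⟨0, 3, ⟨6, 4⟩, 0⟩, ⟨0, 7, ⟨2, 0⟩, ⟨4, 2⟩⟩]

theorem step_S_le_stepS {p q : ℂ} (h : Step piecesS p q) : StepS p q := by
  obtain ⟨hg, m, hm, hp, rfl⟩ := h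
  have hcheck : (piecesS.all fun m => below m.1 2 ⟨4, 4⟩ && below m.1 3 0 &&
      below m.1 5 ⟨-4, -2⟩ && below m.1 6 0 && below (m.2.image m.1) 2 ⟨4, 4⟩ &&
      below (m.2.image m.1) 3 0 && below (m.2.image m.1) 5 ⟨-4, -2⟩ &&
      below (m.2.image m.1) 6 0) = true := by decide +kernel
  have h := List.all_eq_true.1 hcheck m hm
  simp only [Bool.and_eq_true] at h
  obtain ⟨⟨⟨⟨⟨⟨⟨h1, h2⟩, h3⟩, h4⟩, h5⟩, h6⟩, h7⟩, h8⟩ := h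
  have hg' := generic_act (g := m.2).2 hg
  have hp' := mem_image_act (g := m.2).2 hp
  have z : val 0 = 0 := map_zero _
  refine ⟨⟨below_sound h1 hg hp, z ▸ below_sound h2 hg hp, below_sound h3 hg hp,
    z ▸ below_sound h4 hg hp⟩, ⟨below_sound h5 hg' hp', z ▸ below_sound h6 hg' hp',
    below_sound h7 hg' hp', z ▸ below_sound h8 hg' hp'⟩, ?_⟩
  simp only [piecesS, List.mem_cons, List.not_mem_nil, or_false] at hm
  rcases hm with rfl | rfl
  · exact ⟨0, by simp [move]⟩
  · refine ⟨1, ?_⟩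
    rw [Nat.cast_one, one_mul, ← move_zero_act, ← comp_act]
    congr 1

theorem gapCopies_conj_F :
    (gapCopies.all fun φ => returnsConj piecesS piecesF 3 φ) = true := by decide +kernel

theorem stripOctagon_recurs_S : chain piecesS idSim 8 stripOctagon idSim = true := by decide +kernel

/-- A point of a gap, moved by a multiple of the period, recurs unless it comes from a wandering
point of the base region. -/
theorem gap_recurs_or {φ : Sim} (hφ : φ ∈ gapCopies) {c : Octagonal} (hc : c ∈ base) {q : ℂ}
    (hg : Generic q) (hq : Mem (φ.image c) q) (n : ℕ) :
    Recurs StepW (q + n * period) ∨ q ∈ φ.act '' wandering piecesF := by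
  obtain ⟨p, rfl⟩ := act_surjective φ q
  by_cases h : Recurs (Step piecesF) p
  · left
    have h1 := recurs_act (List.all_eq_true.1 gapCopies_conj_F φ hφ) h
    have h2 : Recurs StepS (φ.act p) := recurs_mono (fun _ _ h => .single (step_S_le_stepS h)) h1
    exact recurs_mono (fun _ _ => transGen_of_stepS) (recurs_add_period h2 n)
  · exact .inr ⟨p, ⟨generic_act.1 hg, ⟨c, hc, mem_image_act.1 hq⟩, h⟩, rfl⟩

theorem stripOctagon_recurs {q : ℂ} (hg : Generic q) (hq : Mem stripOctagon q) (n : ℕ) :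
    Recurs StepW (q + n * period) := by
  have h1 := recurs_of_chain stripOctagon_recurs_S hg hq
  have h2 : Recurs StepS q := recurs_mono (fun _ _ h => .single (step_S_le_stepS h)) h1
  exact recurs_mono (fun _ _ => transGen_of_stepS) (recurs_add_period h2 n)

/-- The strip `im z < 2 + 2 √2` of the wedge. -/
def Strip (z : ℂ) : Prop := Wedge z ∧ coord 2 z < val ⟨4, 4⟩

/-- The strip, up to the abscissa `6 + 3 √2`. -/
def nearStrip : Octagonal :=
  ![⟨12, 6⟩, ⟨10, 8⟩, ⟨4, 4⟩, ⟨0, 0⟩, ⟨0, 0⟩, ⟨0, 0⟩, ⟨0, 0⟩, ⟨6, 6⟩]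

/-- The rectangle of the strip between the abscissae `2 + √2` and `6 + 3 √2`, which is one period
long. -/
def farStrip : Octagonal :=
  ![⟨12, 6⟩, ⟨10, 8⟩, ⟨4, 4⟩, ⟨2, 0⟩, ⟨-4, -2⟩, ⟨-2, -2⟩, ⟨0, 0⟩, ⟨6, 6⟩]

theorem nearStrip_cover :
    cover nearStrip (stripOctagon :: (base ++ images gapCopies)) = true := by decide +kernel

theorem farStrip_cover :
    cover farStrip (stripOctagon :: (images gapCopies ++
      (images gapCopies).map (translation ⟨-4, -2⟩ 0).image)) = true := by decide +kernel

theorem mem_nearStrip {z : ℂ} (hz : Strip z) (h0 : coord 0 z < val ⟨12, 6⟩) :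
    Mem nearStrip z := by
  obtain ⟨⟨h6, h3⟩, h2⟩ := hz
  have hs := sqrt_two_sq
  have hs0 : 0 < √2 := by positivity
  simp [coord, twoCos, val_apply] at h0 h2 h3 h6
  have h3' : z.im < z.re := by nlinarith
  have e1 : √2 * (z.re + z.im) < √2 * (8 + 5 * √2) :=
    mul_lt_mul_of_pos_left (by linarith) hs0
  have e2 : √2 * (z.re - z.im) < √2 * (6 + 3 * √2) :=
    mul_lt_mul_of_pos_left (by linarith) hs0
  have e3 : 0 < √2 * (z.re + z.im) := mul_pos hs0 (by linarith)
  intro k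
  fin_cases k <;> simp [coord, twoCos, val_apply, nearStrip] <;> nlinarith

theorem mem_farStrip {z : ℂ} (h6 : coord 6 z < 0) (h2 : coord 2 z < val ⟨4, 4⟩)
    (h0 : coord 0 z < val ⟨12, 6⟩) (h4 : val ⟨4, 2⟩ < coord 0 z) :
    Mem farStrip z := by
  have hs := sqrt_two_sq
  have hs0 : 0 < √2 := by positivity
  simp [coord, twoCos, val_apply] at h0 h2 h4 h6
  have e1 : √2 * (z.re + z.im) < √2 * (8 + 5 * √2) :=
    mul_lt_mul_of_pos_left (by linarith) hs0
  have e2 : √2 * (z.re - z.im) < √2 * (6 + 3 * √2) :=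
    mul_lt_mul_of_pos_left (by linarith) hs0
  have e3 : √2 * (2 + √2) < √2 * (z.re + z.im) :=
    mul_lt_mul_of_pos_left (by linarith) hs0
  have e4 : √2 * (z.im - z.re) < √2 * √2 :=
    mul_lt_mul_of_pos_left (by linarith) hs0
  intro k
  fin_cases k <;> simp [coord, twoCos, val_apply, farStrip] <;> nlinarith

/-- The generic points of the strip that are not periodic. -/
def wanderingStrip : Set ℂ := {z | Generic z ∧ Strip z ∧ ¬ Recurs StepW z}

theorem wanderingStrip_subset : wanderingStrip ⊆ wandering piecesF ∪
    ⋃ (n : ℕ), ⋃ φ ∈ gapCopies, (· + (n * period)) '' (φ.act '' wandering piecesF) := by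
  rintro z ⟨hg, hz, hrec⟩
  have hgap : ∀ {φ : Sim}, φ ∈ gapCopies → ∀ {c : Octagonal}, c ∈ base → ∀ {q : ℂ} (n : ℕ),
      Mem (φ.image c) q → Generic q → q + n * period = z →
      z ∈ wandering piecesF ∪
        ⋃ (n : ℕ), ⋃ φ ∈ gapCopies, (· + (n * period)) '' (φ.act '' wandering piecesF) := by
    rintro φ hφ c hc q n hq hgq rfl
    rcases gap_recurs_or hφ hc hgq hq n with h | h
    · exact absurd h hrec
    · exact .inr (Set.mem_iUnion.2 ⟨n, Set.mem_biUnion hφ ⟨q, h, rfl⟩⟩)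
  by_cases h0 : coord 0 z < val ⟨12, 6⟩
  · obtain ⟨d, hd, hdz⟩ := cover_sound nearStrip_cover hg (mem_nearStrip hz h0)
    rcases List.mem_cons.1 hd with rfl | hd
    · exact absurd (by simpa using stripOctagon_recurs hg hdz 0) hrec
    rcases List.mem_append.1 hd with hd | hd
    · exact .inl ⟨hg, ⟨d, hd, hdz⟩, fun h => hrec (recurs_stepW_of_F h)⟩
    · obtain ⟨φ, hφ, c, hc, rfl⟩ := mem_images.1 hd
      exact hgap hφ hc 0 hdz hg (by simp)
  · -- a multiple of the period brings `z` back to the rectangle `farStrip`; the parts of the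
    -- rectangle in the previous period come from the copies in `gapCopies`, shifted by `-period`
    have hper (n : ℕ) : vec (n * ⟨-4, -2⟩) (n * 0) = -(n * period) := by
      rw [vec_natCast_mul, period]
      simp [vec, val_apply]
      ring
    have hs0 : 0 < √2 := by positivity
    have hc0 (q : ℂ) (n : ℕ) : coord 0 (q - n * period) = coord 0 q - n * (8 + 4 * √2) := by
      rw [sub_eq_add_neg, ← hper, coord_add, coord_vec]
      simp [vecCoord, twoCos, val_apply]
      ring
    have hc2 (q : ℂ) (n : ℕ) : coord 2 (q - n * period) = coord 2 q := by
      rw [sub_eq_add_neg, ← hper, coord_add, coord_vec]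
      simp [vecCoord, twoCos, val_apply]
    have hc6 (q : ℂ) (n : ℕ) : coord 6 (q - n * period) = coord 6 q := by
      rw [sub_eq_add_neg, ← hper, coord_add, coord_vec]
      simp [vecCoord, twoCos, val_apply]
    have hgen (q : ℂ) (n : ℕ) : Generic (q - n * period) ↔ Generic q := by
      rw [sub_eq_add_neg, ← hper, generic_add_vec]
    obtain ⟨n, hn1, hn2⟩ : ∃ n : ℕ, (n + 1 : ℝ) * (8 + 4 * √2) ≤ coord 0 z - (4 + 2 * √2) ∧
        coord 0 z - (4 + 2 * √2) < (n + 2) * (8 + 4 * √2) := by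
      have hpos : 0 < 8 + 4 * √2 := by positivity
      simp only [val_apply] at h0
      push_cast at h0
      have h1 : 1 ≤ (coord 0 z - (4 + 2 * √2)) / (8 + 4 * √2) := by
        rw [le_div_iff₀ hpos]; linarith
      have h2 := Nat.floor_le (zero_le_one.trans h1)
      have h3 := Nat.lt_floor_add_one ((coord 0 z - (4 + 2 * √2)) / (8 + 4 * √2))
      have h4 : 1 ≤ ⌊(coord 0 z - (4 + 2 * √2)) / (8 + 4 * √2)⌋₊ := Nat.le_floor (by simpa using h1)
      obtain ⟨n, hn⟩ := Nat.exists_eq_add_of_le' h4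
      rw [hn] at h2 h3
      rw [le_div_iff₀ hpos] at h2
      rw [div_lt_iff₀ hpos] at h3
      push_cast at h2 h3
      exact ⟨n, h2, by linarith⟩
    set q := z - (n + 1 : ℕ) * period with hq
    have hgq : Generic q := (hgen z (n + 1)).2 hg
    have hlow : val ⟨4, 2⟩ < coord 0 q := by
      refine lt_of_le_of_ne ?_ (hgq 0 _).symm
      rw [hq, hc0, val_apply]
      push_cast
      linarith
    have hqs : Mem farStrip q := by
      refine mem_farStrip ?_ ?_ ?_ hlow
      · rw [hq, hc6]; exact hz.1.1
      · rw [hq, hc2]; exact hz.2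
      · rw [hq, hc0, val_apply]; push_cast; linarith
    obtain ⟨d, hd, hdq⟩ := cover_sound farStrip_cover hgq hqs
    rcases List.mem_cons.1 hd with rfl | hd
    · refine absurd ?_ hrec
      have := stripOctagon_recurs hgq hdq (n + 1)
      rwa [hq, sub_add_cancel] at this
    rcases List.mem_append.1 hd with hd | hd
    · obtain ⟨φ, hφ, c, hc, rfl⟩ := mem_images.1 hd
      exact hgap hφ hc (n + 1) hdq hgq (by rw [hq, sub_add_cancel])
    · obtain ⟨d', hd', rfl⟩ := List.mem_map.1 hd
      obtain ⟨φ, hφ, c, hc, rfl⟩ := mem_images.1 hd'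
      have hz' : z - (n : ℕ) * period = q + period := by rw [hq]; push_cast; ring
      have hback : (translation ⟨-4, -2⟩ 0).act (z - (n : ℕ) * period) = q := by
        have := hper 1
        simp only [Nat.cast_one, one_mul] at this
        rw [translation_act, this, hz']
        ring
      rw [← hback, mem_image_act] at hdq
      exact hgap hφ hc n hdq ((hgen z n).2 hg) (by rw [sub_add_cancel])

theorem volume_wanderingStrip : volume wanderingStrip = 0 := by
  refine measure_mono_null wanderingStrip_subset (measure_union_null volume_wandering_F ?_)
  refine measure_iUnion_null fun n => ?_
  refine (measure_biUnion_null_iff (List.finite_toSet gapCopies).countable).2 fun φ _ => ?_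
  rw [Set.image_add_right, measure_preimage_add_right]
  exact volume_act_image_eq_zero φ volume_wandering_F

theorem volume_wandering_wedge :
    volume {z | Generic z ∧ Wedge z ∧ ¬ Recurs StepW z} = 0 := by
  have hsub : {z | Generic z ∧ Wedge z ∧ ¬ Recurs StepW z} ⊆
      ⋃ n : ℕ, (fun z => z + n * descent) ⁻¹' wanderingStrip := by
    rintro z ⟨hg, hz, hrec⟩
    have hpos : 0 < 4 + 4 * √2 := by positivity
    have hz0 : 0 < coord 2 z := by
      have := coord_add_four 2 z
      have h6 := hz.1
      rw [show (2 + 4 : Fin 8) = 6 from rfl] at this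
      linarith
    set n := ⌊coord 2 z / (4 + 4 * √2)⌋₊
    have h1 := Nat.floor_le (div_pos hz0 hpos).le
    have h2 := Nat.lt_floor_add_one (coord 2 z / (4 + 4 * √2))
    rw [le_div_iff₀ hpos] at h1
    rw [div_lt_iff₀ hpos] at h2
    have hc := (coord_add_descent z n).1
    have hc2 := coord_add_four 2 (z + n * descent)
    have hc2' := coord_add_four 2 z
    rw [show (2 + 4 : Fin 8) = 6 from rfl] at hc2 hc2'
    have hgn (i : ℕ) : Generic (z + i * descent) := by
      rw [descent, ← vec_natCast_mul, generic_add_vec]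
      exact hg
    have hlt : coord 6 (z + n * descent) < 0 := by
      refine lt_of_le_of_ne (by linarith) ?_
      have := hgn n 6 0
      rwa [map_zero] at this
    refine Set.mem_iUnion.2 ⟨n, hgn n, ⟨wedge_add_descent hz hlt le_rfl, ?_⟩, fun h => hrec ?_⟩
    · rw [val_apply]
      push_cast
      linarith
    · have key : ∀ i ≤ n, Recurs StepW (z + i * descent) → Recurs StepW z := by
        intro i
        induction i with
        | zero => intro _ h; simpa using h
        | succ i ih =>
          exact fun hi h => ih (by omega) (recurs_of_stepW (stepW_add_descent hz hlt hi) h)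
      exact key n le_rfl h
  refine measure_mono_null hsub (measure_iUnion_null fun n => ?_)
  rw [measure_preimage_add_right]
  exact volume_wanderingStrip

/-! ### The octagon and its tangents -/

/-- The vertex `v = -1 + (1 + √2) i` of the octagon with centre `0` and side `2`, which is the apex
of the translated wedge `v + Wedge`. -/
noncomputable def apex : ℂ := vec ⟨-2, -1⟩ ⟨2, 1⟩

theorem apex_eq : apex = ⟨-1, 1 + √2⟩ := by
  apply Complex.ext <;> simp [apex, vec, zeta, val_apply] <;> ring_nf <;> simp <;> ring

theorem coord_apex_le (k : Fin 8) : coord k apex ≤ 2 + 2 * √2 := by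
  have hs := sqrt_two_sq
  have hs0 : 0 ≤ √2 := Real.sqrt_nonneg 2
  rw [apex_eq]
  fin_cases k <;> simp [coord, twoCos, val_apply] <;> nlinarith

theorem coord_two_apex : coord 2 apex = 2 + 2 * √2 := by
  rw [apex_eq]; simp [coord, twoCos, val_apply]; ring

theorem coord_three_apex : coord 3 apex = 2 + 2 * √2 := by
  rw [apex_eq]; simp [coord, twoCos, val_apply]; ring_nf; simp; ring

/-- The point of the plane with position `z` relative to the `m`-th vertex, for the octagon with centre
`c` and side `2 |s|`. For `z = 0` it is the vertex itself. -/
noncomputable def place (c s : ℂ) (m : Fin 8) (z : ℂ) : ℂ := c + s * (zeta ^ (m : ℕ) * (apex + z))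

/-- The regular octagon with centre `c` and side `2 |s|`. -/
noncomputable def octagon (c s : ℂ) : Set ℂ :=
  convexHull ℝ (Set.range fun k : Fin 8 => place c s k 0)

theorem octagon_subset {c s x : ℂ} (hx : x ∈ octagon c s) :
    ∃ u, x = c + s * u ∧ ∀ k, coord k u ≤ 2 + 2 * √2 := by
  have hconv : Convex ℝ {x : ℂ | ∃ u, x = c + s * u ∧ ∀ k, coord k u ≤ 2 + 2 * √2} := by
    rintro _ ⟨u, rfl, hu⟩ _ ⟨v, rfl, hv⟩ a b ha hb hab
    refine ⟨a * u + b * v, ?_, fun k => ?_⟩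
    · have : (a : ℂ) + b = 1 := by exact_mod_cast hab
      simp only [Complex.real_smul]
      linear_combination c * this
    · rw [coord_add, coord_real_mul, coord_real_mul]
      calc a * coord k u + b * coord k v ≤ a * (2 + 2 * √2) + b * (2 + 2 * √2) := by
            gcongr
            exacts [hu k, hv k]
        _ = 2 + 2 * √2 := by rw [← add_mul, hab, one_mul]
  refine convexHull_min ?_ hconv hx
  rintro _ ⟨m, rfl⟩
  refine ⟨zeta ^ (m : ℕ) * apex, by simp [place], fun k => ?_⟩
  rw [coord_rotate]
  exact coord_apex_le _

theorem exists_sign_change {f : Fin 8 → ℝ} (hf : ∀ k, f (k + 4) = -f k) :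
    ∃ k, 0 ≤ f k ∧ f (k + 1) ≤ 0 := by
  by_contra! h
  have h0 := hf 0
  have h1 := hf 1
  have h2 := hf 2
  have h3 := hf 3
  have g (k : Fin 8) := h k
  have g0 := g 0; have g1 := g 1; have g2 := g 2; have g3 := g 3
  have g4 := g 4; have g5 := g 5; have g6 := g 6; have g7 := g 7
  simp only [Fin.reduceAdd, zero_add] at *
  rcases le_total 0 (f 0) with p | p
  · have a := g1 (g0 p).le
    linarith [g3 (g2 a.le).le]
  · have a := g5 (g4 (by linarith)).le
    have b := g7 (g6 a.le).le
    have a := g1 (g0 b.le).le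
    linarith [g3 (g2 a.le).le]

theorem convex_combo_mem {K : Set ℂ} (hK : Convex ℝ K) {o p q : ℂ} (ho : o ∈ K)
    (hp : p ∈ K) (hq : q ∈ K) {a b : ℝ} (ha : 0 ≤ a) (hb : 0 ≤ b) (hab : a + b ≤ 1) :
    (1 - a - b : ℝ) * o + a * p + b * q ∈ K := by
  have := hK.sum_mem (t := Finset.univ) (w := ![1 - a - b, a, b]) (z := ![o, p, q])
    (by intro i _; fin_cases i <;> simp <;> linarith)
    (by simp [Fin.sum_univ_three]; ring)
    (by intro i _; fin_cases i <;> simp [ho, hp, hq])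
  simpa [Fin.sum_univ_three, Complex.real_smul] using this

/-- The octagon contains the intersection of the half-planes of its sides. -/
theorem mem_octagon {c s u : ℂ} (hu : ∀ k, coord k u ≤ 2 + 2 * √2) : c + s * u ∈ octagon c s := by
  have hs2 := sqrt_two_sq
  have hs0 : 0 ≤ √2 := Real.sqrt_nonneg 2
  -- the sector spanned by the vertices `m + 7` and `m` that contains `u`
  obtain ⟨m, hm1, hm2⟩ := exists_sign_change
    (f := fun k => coord (k + 2) u - (1 + √2) * coord k u) (by
      intro k
      have h1 := coord_add_four k u
      have h2 := coord_add_four (k + 2) u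
      rw [show k + 4 + 2 = k + 2 + 4 by abel, h1, h2]
      ring)
  -- the sector is rotated to the one around the vertical axis, spanned by `apex` and `ζ ^ 7 * apex`
  set u' := zeta ^ ((-m : Fin 8) : ℕ) * u with hu'
  have hc (k : Fin 8) : coord k u' = coord (k + m) u := by
    rw [hu', coord_rotate, sub_neg_eq_add]
  have huu : u = zeta ^ (m : ℕ) * u' := by rw [hu', ← mul_assoc, zeta_pow_mul_neg, one_mul]
  have e0 := hc 0
  have e1 := hc 1
  have e2 := hc 2
  have e3 := hc 3
  have hb := hu (2 + m)
  rw [← e2] at hb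
  rw [add_comm m 2, ← e2, ← zero_add m, ← e0] at hm1
  rw [show m + 1 + 2 = 3 + m by abel, add_comm m 1, ← e3, ← e1] at hm2
  clear e0 e1 e2 e3
  simp [coord, twoCos, val_apply] at hm1 hm2 hb
  have hK := convex_convexHull ℝ (Set.range fun k : Fin 8 => place c s k 0)
  have hv (k : Fin 8) : place c s k 0 ∈ octagon c s := subset_convexHull ℝ _ ⟨k, rfl⟩
  have hcen : c ∈ octagon c s := by
    have := hK (hv 0) (hv 4) (a := 1 / 2) (b := 1 / 2) (by norm_num) (by norm_num) (by norm_num)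
    have e : (1 / 2 : ℝ) • place c s 0 0 + (1 / 2 : ℝ) • place c s 4 0 = c := by
      have h0 : ((0 : Fin 8) : ℕ) = 0 := rfl
      have h4 : ((4 : Fin 8) : ℕ) = 4 := rfl
      simp only [place, h0, h4, zeta_pow_four, Complex.real_smul]
      push_cast
      ring
    rwa [e] at this
  have ht : 0 < 1 + √2 := by positivity
  obtain ⟨a, b, ha, hb0, hab, hre, him⟩ : ∃ a b : ℝ, 0 ≤ a ∧ 0 ≤ b ∧ a + b ≤ 1 ∧
      u'.re = b - a ∧ u'.im = (1 + √2) * (a + b) := by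
    have e1 : √2 * √2 * u'.re = 2 * u'.re := by rw [hs2]
    have e2 : √2 * √2 * u'.im = 2 * u'.im := by rw [hs2]
    have h1 : u'.re ≤ u'.im / (1 + √2) := by rw [le_div_iff₀ ht]; linarith
    have h2 : -u'.re ≤ u'.im / (1 + √2) := by rw [le_div_iff₀ ht]; linarith
    have h3 : u'.im / (1 + √2) ≤ 1 := by rw [div_le_iff₀ ht]; linarith
    refine ⟨(u'.im / (1 + √2) - u'.re) / 2, (u'.im / (1 + √2) + u'.re) / 2, by linarith,
      by linarith, by linarith, by ring, ?_⟩
    field_simp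
    ring
  have h7 : zeta ^ 7 * apex = ⟨1, 1 + √2⟩ := by
    have h8 := zeta_pow_eight
    have : apex = zeta * ⟨1, 1 + √2⟩ := by
      rw [apex_eq]
      apply Complex.ext <;> simp [zeta] <;> ring_nf <;> simp <;> ring
    rw [this]
    linear_combination (⟨1, 1 + √2⟩ : ℂ) * h8
  have hdec : u' = a * apex + b * (zeta ^ 7 * apex) := by
    rw [h7, apex_eq]
    apply Complex.ext
    · simp [hre]; ring
    · simp [him]; ring
  have key := convex_combo_mem hK hcen (hv m) (hv (m + 7)) ha hb0 hab
  have e : c + s * u = (1 - a - b : ℝ) * c + a * place c s m 0 + b * place c s (m + 7) 0 := by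
    have e7 : ((7 : Fin 8) : ℕ) = 7 := rfl
    rw [huu, hdec]
    simp only [place, add_zero, zeta_pow_add, e7]
    push_cast
    ring
  rw [e]
  exact key

theorem cross_mul (s a b : ℂ) : cross (s * a) (s * b) = Complex.normSq s * cross a b := by
  simp [cross, Complex.normSq_apply]; ring

/-- From a point of the wedge, the other points of the octagon lie strictly to the left of the line of
sight to the apex. -/
theorem cross_tangent {z u : ℂ} (hz : Wedge z) (hu : ∀ k, coord k u ≤ 2 + 2 * √2)
    (h : u ≠ apex) : 0 < cross (-z) (u - (apex + z)) := by
  have hs0 : 0 < √2 := by positivity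
  obtain ⟨d, rfl⟩ : ∃ d, u = apex + d := ⟨u - apex, by ring⟩
  have h2 := hu 2
  have h3 := hu 3
  rw [coord_add, coord_two_apex] at h2
  rw [coord_add, coord_three_apex] at h3
  obtain ⟨h6, hz3⟩ := hz
  have hd : d ≠ 0 := by rintro rfl; simp at h
  simp [coord, twoCos, val_apply] at h2 h3 h6 hz3
  have h2 : d.im ≤ 0 := by linarith
  have e : cross (-z) (apex + d - (apex + z)) =
      z.im * (d.re - d.im) + (z.re - z.im) * -d.im := by simp [cross]; ring
  rw [e]
  rcases h2.lt_or_eq with h | h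
  · exact add_pos_of_nonneg_of_pos (mul_nonneg h6.le (by linarith))
      (mul_pos (by linarith) (by linarith))
  · have : 0 < d.re := by
      refine lt_of_le_of_ne (by linarith) fun h' => hd ?_
      exact Complex.ext h'.symm h
    rw [h]
    simp only [sub_zero, neg_zero, mul_zero, add_zero]
    exact mul_pos h6 this

variable {c s : ℂ}

theorem exists_rotated {x : ℂ} (m : Fin 8) (hx : x ∈ octagon c s) :
    ∃ u, x = c + s * (zeta ^ (m : ℕ) * u) ∧ ∀ k, coord k u ≤ 2 + 2 * √2 := by
  obtain ⟨u, rfl, hu⟩ := octagon_subset hx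
  refine ⟨zeta ^ ((-m : Fin 8) : ℕ) * u, ?_, fun k => ?_⟩
  · rw [← mul_assoc (zeta ^ (m : ℕ)), zeta_pow_mul_neg, one_mul]
  · rw [coord_rotate]; exact hu _

theorem place_notMem {z : ℂ} (hs : s ≠ 0) (m : Fin 8) (hz : Wedge z) :
    place c s m z ∉ octagon c s := by
  intro h
  obtain ⟨u, h1, hu⟩ := exists_rotated m h
  have h2 : apex + z = u :=
    mul_left_cancel₀ (pow_ne_zero _ zeta_ne_zero) (mul_left_cancel₀ hs (add_left_cancel h1))
  have h3 := hu 2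
  have h4 := coord_add_four 2 z
  rw [← h2, coord_add, coord_two_apex] at h3
  rw [show (2 + 4 : Fin 8) = 6 from rfl] at h4
  linarith [hz.1]

theorem cross_place_pos {z x : ℂ} (hs : s ≠ 0) (m : Fin 8) (hz : Wedge z) (hx : x ∈ octagon c s)
    (hne : x ≠ place c s m 0) :
    0 < cross (place c s m 0 - place c s m z) (x - place c s m z) := by
  obtain ⟨u, rfl, hu⟩ := exists_rotated m hx
  have e1 : place c s m 0 - place c s m z = (s * zeta ^ (m : ℕ)) * (-z) := by
    simp only [place]; ring
  have e2 : c + s * (zeta ^ (m : ℕ) * u) - place c s m z =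
      (s * zeta ^ (m : ℕ)) * (u - (apex + z)) := by
    simp only [place]; ring
  have h0 : s * zeta ^ (m : ℕ) ≠ 0 := mul_ne_zero hs (pow_ne_zero _ zeta_ne_zero)
  rw [e1, e2, cross_mul]
  refine mul_pos (Complex.normSq_pos.2 h0) (cross_tangent hz hu ?_)
  rintro rfl
  exact hne (by simp [place])

theorem move_act_add_apex (j : Fin 4) (z : ℂ) :
    apex + (move j).act z = zeta ^ ((move j).r : ℕ) * (z - apex) := by
  have h : vec (move j).x (move j).y + apex = -(zeta ^ ((move j).r : ℕ) * apex) := by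
    rw [apex, vec_rotate, ← vec_neg, vec_add]
    congr 1 <;> revert j <;> decide
  have hl : lam (move j).e = 1 := by fin_cases j <;> rfl
  rw [Sim.act, hl, map_one]
  push_cast
  linear_combination h

/-- In relative position, the billiard acts by `move j`, for every `j`; the choice of `j` is a choice
of the vertex to which the image is referred. -/
theorem outerBilliard_place {z : ℂ} (hs : s ≠ 0) (m : Fin 8) (hz : Wedge z) (j : Fin 4) :
    place c s (m + 4 - (move j).r) ((move j).act z) ∈
      outerBilliard (octagon c s) (place c s m z) := by
  have hv : place c s m 0 ∈ octagon c s := subset_convexHull ℝ _ ⟨m, rfl⟩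
  have htan : IsRightTangentPoint (octagon c s) (place c s m z) (place c s m 0) := by
    refine ⟨hv, fun x hx => ?_⟩
    by_cases hne : x = place c s m 0
    · rw [hne]; simp [cross, mul_comm]
    · exact (cross_place_pos hs m hz hx hne).le
  have huniq : ∀ q, IsRightTangentPoint (octagon c s) (place c s m z) q →
      q = place c s m 0 := by
    rintro q ⟨hq, hq'⟩
    by_contra hne
    have h1 := cross_place_pos hs m hz hq hne
    have h2 := hq' _ hv
    simp only [cross] at h1 h2
    linarith
  have hdom : place c s m z ∉ octagon c s ∧
      ∃! q, IsRightTangentPoint (octagon c s) (place c s m z) q :=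
    ⟨place_notMem hs m hz, _, htan, huniq⟩
  refine ⟨hdom, ?_⟩
  change 2 * hdom.2.choose - place c s m z = _
  rw [huniq _ hdom.2.choose_spec.1]
  have h1 := move_act_add_apex j z
  have h2 : zeta ^ ((m + 4 - (move j).r : Fin 8) : ℕ) * zeta ^ ((move j).r : ℕ) =
      -zeta ^ (m : ℕ) := by
    rw [← zeta_pow_add, sub_add_cancel, zeta_pow_add]
    have : zeta ^ ((4 : Fin 8) : ℕ) = -1 := zeta_pow_four
    rw [this]
    ring
  simp only [place]
  rw [h1, ← mul_assoc (zeta ^ _), h2]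
  ring

/-! ### Periodic points of the billiard -/

theorem mem_iterate_succ {T : ℂ →. ℂ} {p r : ℂ} {n : ℕ} :
    r ∈ iterate T (n + 1) p ↔ ∃ q ∈ iterate T n p, r ∈ T q := Part.mem_bind_iff

theorem iterate_add {T : ℂ →. ℂ} {p q r : ℂ} {a b : ℕ} (h : q ∈ iterate T a p)
    (h' : r ∈ iterate T b q) : r ∈ iterate T (a + b) p := by
  induction b generalizing r with
  | zero =>
    rw [iterate, PFun.id_apply, Part.mem_some_iff] at h'
    rwa [h']
  | succ b ih =>
    obtain ⟨r', h1, h2⟩ := mem_iterate_succ.1 h'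
    rw [← Nat.add_assoc, mem_iterate_succ]
    exact ⟨r', ih h1, h2⟩

theorem iterate_one {T : ℂ →. ℂ} {p q : ℂ} (h : q ∈ T p) : q ∈ iterate T 1 p := by
  exact mem_iterate_succ.2 ⟨p, by simp [iterate], h⟩

/-- Steps in the wedge are steps of the billiard; they turn the vertex of reference by an amount that
does not depend on it. -/
theorem iterate_of_transGen {z z' : ℂ} (hs : s ≠ 0) (h : Relation.TransGen StepW z z') :
    ∃ n, 1 ≤ n ∧ ∃ d, ∀ m,
      place c s (m + d) z' ∈ iterate (outerBilliard (octagon c s)) n (place c s m z) := by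
  induction h with
  | single h =>
    obtain ⟨hz, -, j, rfl⟩ := h
    refine ⟨1, le_rfl, 4 - (move j).r, fun m => ?_⟩
    rw [← add_sub_assoc]
    exact iterate_one (outerBilliard_place hs m hz j)
  | tail _ h ih =>
    obtain ⟨n, hn, d, hd⟩ := ih
    obtain ⟨hz, -, j, rfl⟩ := h
    refine ⟨n + 1, by omega, d + (4 - (move j).r), fun m => ?_⟩
    rw [← add_assoc, ← add_sub_assoc]
    exact iterate_add (hd m) (iterate_one (outerBilliard_place hs (m + d) hz j))

/-- When the relative position comes back, the vertex of reference has been turned; after eight times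
as many steps, the point itself is back. -/
theorem isPeriodicPoint_place {z : ℂ} (hs : s ≠ 0) (m : Fin 8) (hz : Wedge z)
    (h : Recurs StepW z) : IsPeriodicPoint (octagon c s) (place c s m z) := by
  refine ⟨place_notMem hs m hz, ?_⟩
  obtain ⟨n, hn, d, hd⟩ := iterate_of_transGen (c := c) hs h
  have key (k : ℕ) : place c s (m + k • d) z ∈
      iterate (outerBilliard (octagon c s)) (k * n) (place c s m z) := by
    induction k with
    | zero => simp [iterate]
    | succ k ih =>
      rw [Nat.succ_mul, succ_nsmul, ← add_assoc]
      exact iterate_add ih (hd _)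
  have h8 : ∀ d : Fin 8, 8 • d = 0 := by decide
  have := key 8
  rw [h8, add_zero] at this
  exact ⟨8 * n, by omega, this⟩

theorem volume_coord_eq (k : Fin 8) (a : ℝ) : volume {p | coord k p = a} = 0 := by
  let f : ℂ →ₗ[ℝ] ℝ :=
    { toFun := coord k
      map_add' := coord_add k
      map_smul' := fun r p => by simpa using coord_real_mul k r p }
  have hne : LinearMap.ker f ≠ ⊤ := by
    intro h
    have h1 : zeta ^ (k : ℕ) * 1 ∈ LinearMap.ker f := h ▸ Submodule.mem_top
    have h2 : coord k (zeta ^ (k : ℕ) * 1) = 0 := h1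
    rw [coord_rotate, sub_self, coord_one] at h2
    norm_num [twoCos, val_apply] at h2
  rcases Set.eq_empty_or_nonempty {p | coord k p = a} with h | ⟨p₀, hp₀⟩
  · rw [h, measure_empty]
  · have h : {p | coord k p = a} = (fun p => p + -p₀) ⁻¹' (LinearMap.ker f : Set ℂ) := by
      ext p
      have e : f (p + -p₀) = coord k p - a := by
        rw [map_add, map_neg, ← sub_eq_add_neg]
        exact congrArg (coord k p - ·) hp₀
      simp only [Set.mem_preimage, SetLike.mem_coe, LinearMap.mem_ker, e, sub_eq_zero]
      rfl
    rw [h, measure_preimage_add_right]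
    exact Measure.addHaar_submodule _ _ hne

theorem volume_not_generic : volume {p | ¬ Generic p} = 0 := by
  have : {p | ¬ Generic p} = ⋃ k : Fin 8, ⋃ x : ℤ × ℤ, {p | coord k p = val ⟨x.1, x.2⟩} := by
    ext p
    simp only [Generic, ne_eq, not_forall, not_not, Set.mem_ofPred_eq, Set.mem_iUnion]
    exact exists_congr fun k => ⟨fun ⟨x, hx⟩ => ⟨(x.re, x.im), hx⟩, fun ⟨x, hx⟩ => ⟨_, hx⟩⟩
  rw [this]
  exact measure_iUnion_null fun k => measure_iUnion_null fun x => volume_coord_eq k _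

/-- A generic point outside the octagon lies beyond some side but not beyond the next one, which puts
it into a wedge. -/
theorem exists_place {u : ℂ} (hg : Generic u) (hu : ∃ k, 2 + 2 * √2 < coord k u) :
    ∃ m z, Generic z ∧ Wedge z ∧ u = zeta ^ (m : Fin 8).val * (apex + z) := by
  have hv : val ⟨2, 2⟩ = 2 + 2 * √2 := by simp [val_apply]
  obtain ⟨k, hk1, hk2⟩ : ∃ k, 2 + 2 * √2 < coord k u ∧ coord (k + 1) u < 2 + 2 * √2 := by
    by_contra! h
    have hstep : ∀ k, 2 + 2 * √2 < coord k u → 2 + 2 * √2 < coord (k + 1) u := fun k hk =>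
      lt_of_le_of_ne (h k hk) (hv ▸ (hg (k + 1) _).symm)
    obtain ⟨k, hk⟩ := hu
    have h4 := hstep _ (hstep _ (hstep _ (hstep _ hk)))
    have e : ∀ k : Fin 8, k + 1 + 1 + 1 + 1 = k + 4 := by decide
    rw [e, coord_add_four] at h4
    have := Real.sqrt_nonneg 2
    linarith
  let g : Sim := ⟨0, -(k - 2), -⟨-2, -1⟩, -⟨2, 1⟩⟩
  have hz : g.act u = zeta ^ ((-(k - 2) : Fin 8) : ℕ) * u - apex := by
    simp only [Sim.act, g, lam, map_one, vec_neg, apex]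
    push_cast
    ring
  have hc (j : Fin 8) : coord j (g.act u) + coord j apex = coord (j + (k - 2)) u := by
    rw [← coord_add, hz, sub_add_cancel, coord_rotate, sub_neg_eq_add]
  refine ⟨k - 2, g.act u, generic_act.2 hg, ⟨?_, ?_⟩, ?_⟩
  · have h1 := hc 2
    have h2 := coord_add_four 2 (g.act u)
    rw [add_sub_cancel, coord_two_apex] at h1
    rw [show (2 + 4 : Fin 8) = 6 from rfl] at h2
    linarith
  · have h1 := hc 3
    have e : ∀ k : Fin 8, 3 + (k - 2) = k + 1 := by decide
    rw [e, coord_three_apex] at h1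
    linarith
  · rw [hz, add_sub_cancel, ← mul_assoc, zeta_pow_mul_neg, one_mul]

theorem volume_not_periodic (hs : s ≠ 0) :
    volume ((octagon c s)ᶜ \ {p : ℂ | IsPeriodicPoint (octagon c s) p}) = 0 := by
  have hsub : (octagon c s)ᶜ \ {p : ℂ | IsPeriodicPoint (octagon c s) p} ⊆
      (fun u => s * u + c) '' ({u | ¬ Generic u} ∪ ⋃ m : Fin 8,
        (fun z => zeta ^ (m : ℕ) * z + zeta ^ (m : ℕ) * apex) ''
          {z | Generic z ∧ Wedge z ∧ ¬ Recurs StepW z}) := by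
    rintro p ⟨hp, hper⟩
    obtain ⟨u, rfl⟩ : ∃ u, p = c + s * u := ⟨(p - c) / s, by field_simp; ring⟩
    refine ⟨u, ?_, add_comm _ _⟩
    by_cases hg : Generic u
    · right
      obtain ⟨m, z, hgz, hz, rfl⟩ := exists_place hg (by
        by_contra! h
        exact hp (mem_octagon h))
      refine Set.mem_iUnion.2 ⟨m, z, ⟨hgz, hz, fun h => hper ?_⟩, by ring⟩
      exact isPeriodicPoint_place hs m hz h
    · exact .inl hg
  refine measure_mono_null hsub ?_
  rw [volume_affine, measure_union_null volume_not_generic, mul_zero]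
  refine measure_iUnion_null fun m => ?_
  rw [volume_affine, volume_wandering_wedge, mul_zero]

end OuterBilliard

open OuterBilliard in
theorem mainTheorem2 (γ : Set ℂ) (hγ : OuterBilliard.IsRegularOctagon γ) :
    MeasureTheory.volume (γᶜ \ {p : ℂ | OuterBilliard.IsPeriodicPoint γ p}) = 0 := by
  obtain ⟨c, w, hw, rfl⟩ := hγ
  have ha : apex ≠ 0 := by
    rw [apex_eq]
    intro h
    simpa using congrArg Complex.re h
  have hz : zeta = Complex.exp ((Real.pi / 4 : ℝ) * Complex.I) := by
    rw [Complex.exp_mul_I, ← Complex.ofReal_cos, ← Complex.ofReal_sin, Real.cos_pi_div_four,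
      Real.sin_pi_div_four]
    apply Complex.ext <;> simp [zeta]
  have h : (fun k : Fin 8 => c + w * Complex.exp (((k : ℕ) : ℂ) * (Real.pi / 4 : ℝ) * Complex.I)) =
      fun k : Fin 8 => place c (w / apex) k 0 := by
    ext k
    rw [place, add_zero, mul_assoc ((k : ℕ) : ℂ), Complex.exp_nat_mul, ← hz]
    field_simp
  rw [h]
  exact volume_not_periodic (div_ne_zero hw ha)
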